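/- For $n\equiv 0 \pmod 4$ let $G=G(n,n/2,n/4)$ be the complete distance graph: its vertices are the vectors $\mathbf x\in\{0,1\}^n$ with $x_1+\dots+x_n=n/2$, and two distinct vertices $\mathbf x,\mathbf y$ are adjacent if and only if $\langle \mathbf x,\mathbf y\rangle=n/4$. Let $N=N(n)$ be its number of vertices and $N_1=N_1(n)$ the common degree of its vertices. For $p\in[0,1]$ let $G_p$ be the random spanning subgraph of $G$ in which every edge of $G$ is kept with probability $p$ independently of the other edges. Let $F$ be a finite strictly balanced graph, that is, $e(H)/v(H)<e(F)/v(F)$ for every proper nonempty subgraph $H$ of $F$, where $v$ and $e$ denote the numbers of vertices and edges. Let $F$ have $k$ vertices, $l\ge 1$ edges and $a$ automorphisms. Let $c>0$ be a constant and let $p=p(n)\in[0,1]$ satisfy $$p\sim c\,N^{-k/l}\,\frac{N}{N_1}\qquad (n\to\infty,\ n\equiv 0 \pmod 4).$$ Let $X_F$ be the number of copies of $F$ in $G_p$, that is, the number of (not necessarily induced) subgraphs of $G_p$ isomorphic to $F$. Then, as $n\to\infty$ along the multiples of $4$, the distribution of $X_F$ converges weakly to the Poisson distribution with parameter $\lambda=c^l/a$.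 -/

import Mathlib

open Filter Topology MeasureTheory ProbabilityTheory Asymptotics

namespace RandomDistanceGraph

/-- The vertices of the complete distance graph `G(n, n/2, n/4)`: the vectors `x ∈ {0,1}ⁿ` with
`x₁ + ⋯ + xₙ = n/2`. The condition is written without division. -/
abbrev Vert (n : ℕ) : Type :=
  {x : Fin n → Fin 2 // 2 * ∑ i, (x i : ℕ) = n}

/-- The complete distance graph `G(n, n/2, n/4)`: distinct vertices `x`, `y` are adjacent iff their
Euclidean scalar product is `n/4`. For `n > 0` the requirement `x ≠ y` is automatic, since
`⟨x, x⟩ = n/2`. -/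
def distanceGraph (n : ℕ) : SimpleGraph (Vert n) where
  Adj x y := x ≠ y ∧ 4 * ∑ i, (x.1 i : ℕ) * (y.1 i : ℕ) = n
  symm := ⟨fun x y h => ⟨h.1.symm, by simpa only [mul_comm] using h.2⟩⟩
  loopless := ⟨fun _ h => h.1 rfl⟩

instance (n : ℕ) : DecidableRel (distanceGraph n).Adj := fun x y =>
  inferInstanceAs (Decidable (x ≠ y ∧ 4 * ∑ i, (x.1 i : ℕ) * (y.1 i : ℕ) = n))

/-- `N = N(n)`, the number of vertices of the complete distance graph. -/
def numVert (n : ℕ) : ℕ := Fintype.card (Vert n)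

/-- `N₁ = N₁(n)`, the degree of the complete distance graph. The graph is regular
(`isRegularOfDegree_distanceGraph`), so the maximal degree is the degree of every vertex. -/
def vertDegree (n : ℕ) : ℕ := (distanceGraph n).maxDegree

/-- Any two vertices of the complete distance graph differ by a permutation of the coordinates. -/
theorem exists_perm (n : ℕ) (x y : Vert n) :
    ∃ σ : Equiv.Perm (Fin n), ∀ i, y.1 (σ i) = x.1 i := by
  have key : ∀ z : Vert n, 2 * Fintype.card {i // z.1 i = 1} = n := by
    intro z
    have h := z.2
    rw [Fintype.card_subtype, Finset.card_filter]
    rw [← Finset.sum_congr rfl (fun i _ => ?_)]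
    · exact h
    · have : ∀ a : Fin 2, (a : ℕ) = if a = 1 then 1 else 0 := by decide
      exact this _
  have hc : Fintype.card {i // x.1 i = 1} = Fintype.card {i // y.1 i = 1} := by
    have := key x
    have := key y
    omega
  let e := Fintype.equivOfCardEq hc
  refine ⟨e.extendSubtype, fun i => ?_⟩
  have h2 : ∀ a b : Fin 2, (a = 1 ↔ b = 1) → a = b := by decide
  refine h2 _ _ ⟨fun h => ?_, fun h => e.extendSubtype_mem i h⟩
  by_contra hx
  exact e.extendSubtype_not_mem i hx h

/-- A permutation of the coordinates is an automorphism of the complete distance graph. -/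
def permIso (n : ℕ) (σ : Equiv.Perm (Fin n)) : distanceGraph n ≃g distanceGraph n where
  toFun x := ⟨x.1 ∘ σ, by simpa using (Equiv.sum_comp σ fun i => (x.1 i : ℕ)) ▸ x.2⟩
  invFun x := ⟨x.1 ∘ σ.symm, by simpa using (Equiv.sum_comp σ.symm fun i => (x.1 i : ℕ)) ▸ x.2⟩
  left_inv x := by ext; simp
  right_inv x := by ext; simp
  map_rel_iff' := by
    intro x y
    have h := Equiv.sum_comp σ fun i => (x.1 i : ℕ) * (y.1 i : ℕ)
    simp only [distanceGraph, Equiv.coe_fn_mk, Function.comp_apply, ne_eq, Subtype.mk.injEq, h]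
    rw [σ.surjective.injective_comp_right.eq_iff, Subtype.ext_iff]

/-- The complete distance graph is regular of degree `N₁`. -/
theorem isRegularOfDegree_distanceGraph (n : ℕ) :
    (distanceGraph n).IsRegularOfDegree (vertDegree n) := by
  intro x
  have : Nonempty (Vert n) := ⟨x⟩
  obtain ⟨y, hy⟩ := (distanceGraph n).exists_maximal_degree_vertex
  obtain ⟨σ, hσ⟩ := exists_perm n x y
  have hxy : permIso n σ y = x := Subtype.ext (funext hσ)
  rw [vertDegree, hy, ← hxy]
  exact (permIso n σ).degree_eq y

/-- The law of the random subgraph `G_p` of a graph `G`: every edge of `G` is kept with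
probability `p` independently of the other edges. -/
noncomputable def randomSubgraph {V : Type*} (G : SimpleGraph V) (p : unitInterval) :
    Measure (SimpleGraph V) :=
  (setBernoulli G.edgeSet p).comap SimpleGraph.edgeSet

instance {V : Type*} [Countable V] (G : SimpleGraph V) (p : unitInterval) :
    IsProbabilityMeasure (randomSubgraph G p) := by
  refine SimpleGraph.measurableEmbedding_edgeSet.isProbabilityMeasure_comap ?_
  filter_upwards [setBernoulli_ae_subset] with s hs
  refine ⟨.fromEdgeSet s, ?_⟩
  rw [SimpleGraph.edgeSet_fromEdgeSet, sdiff_eq_left, Set.disjoint_left]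
  exact fun e he hd => G.not_isDiag_of_mem_edgeSet (hs he) hd

/-- A spanning subgraph `G' ≤ G` has probability `p^{|E'|} (1 - p)^{|E| - |E'|}`. -/
theorem randomSubgraph_real_singleton {V : Type*} [Finite V] {G G' : SimpleGraph V}
    (p : unitInterval) (h : G' ≤ G) :
    (randomSubgraph G p).real {G'} =
      (p : ℝ) ^ G'.edgeSet.ncard * (1 - p : ℝ) ^ (G.edgeSet.ncard - G'.edgeSet.ncard) := by
  have hs : G'.edgeSet ⊆ G.edgeSet := SimpleGraph.edgeSet_mono h
  rw [measureReal_def, randomSubgraph, SimpleGraph.measurableEmbedding_edgeSet.comap_apply,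
    Set.image_singleton, ← measureReal_def, setBernoulli_real_singleton p hs (Set.toFinite _),
    Set.ncard_sdiff hs]

/-- A finite graph `F` is strictly balanced if `e(H)/v(H) < e(F)/v(F)` for every proper nonempty
subgraph `H` of `F`. -/
def IsStrictlyBalanced {W : Type*} (F : SimpleGraph W) : Prop :=
  ∀ H : F.Subgraph, H ≠ ⊤ → H.verts.Nonempty →
    (H.edgeSet.ncard : ℝ) / H.verts.ncard < (F.edgeSet.ncard : ℝ) / Nat.card W

/-- The way `n` tends to infinity: `n → ∞` along the multiples of `4`. -/
def multiplesOfFour : Filter ℕ := atTop ⊓ 𝓟 {n | 4 ∣ n}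

end RandomDistanceGraph

open RandomDistanceGraph

namespace RandomDistanceGraph

/-! ### The method of factorial moments for the Poisson distribution -/

/-! The method is that of factorial moments: it suffices that E (X_F)_r → λ^r for every r
(`tendstoInDistribution_poisson_of_tendsto_descFactorial`). Times a^r, this moment is the sum of
p^(edges of the union) over the r-tuples of labelled copies of F in G whose unlabelled copies are
distinct. It is compared with (L p^l)^r, where L is the number of labelled copies in G
(`abs_moment_sub_le`).

Vertex-disjoint tuples contribute equally to both. If two copies meet, strict balance gives k e ≥ l
v + 1 for a union with v vertices and e edges. Counting O(N^v) such tuples, without asking that they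
lie in G, yields N^v p^((vl+1)/k), which is of order N^(-1/l) times a power of N/N₁. This tends to
0, since N is exponential in n while N₁/N has order n^(-1/2).

It remains that L ~ N^k (N₁/N)^l. A map from W to the vertices is a sequence of n columns in
{0,1}^W; it is a homomorphism iff the total deviations of the k bits and of the l products along
edges vanish. For independent uniform columns this is a local limit theorem, proved by Fourier
inversion (`homCount_eq_integral`), a Gaussian bound (`exists_norm_devChar_le`) and dominated
convergence. In Walsh coordinates the covariance form is triangular, so the limiting integral splits
into k vertex factors and l edge factors (`integral_exp_neg_devVariance`). The cases of one vertex
and one edge express these factors through N and N₁/N, so they are never evaluated. Non-injective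
homomorphisms are negligible. -/

theorem norm_one_add_pow_sub_sum_choose_le {z : ℂ} (hz : ‖1 + z‖ ≤ 1) (x m : ℕ) :
    ‖(1 + z) ^ x - ∑ r ∈ Finset.range m, (x.choose r : ℂ) * z ^ r‖ ≤ x.choose m * ‖z‖ ^ m := by
  rcases m with _ | m
  · simpa using pow_le_one₀ (norm_nonneg _) hz
  induction x with
  | zero => simp [Finset.sum_range_succ']
  | succ x ih =>
    -- Pascal's rule gives a recursion for the remainder, whose factor `1 + z` has norm at most 1.
    have key : (1 + z) ^ (x + 1) - ∑ r ∈ Finset.range (m + 1), ((x + 1).choose r : ℂ) * z ^ r =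
        (1 + z) * ((1 + z) ^ x - ∑ r ∈ Finset.range (m + 1), (x.choose r : ℂ) * z ^ r) +
          x.choose m * z ^ (m + 1) := by
      have h : ∀ j : ℕ, ∑ r ∈ Finset.range (j + 1), ((x + 1).choose r : ℂ) * z ^ r =
          (1 + z) * (∑ r ∈ Finset.range (j + 1), (x.choose r : ℂ) * z ^ r) -
            x.choose j * z ^ (j + 1) := by
        intro j
        induction j with
        | zero => simp
        | succ j ihj =>
          rw [Finset.sum_range_succ, ihj, Finset.sum_range_succ _ (j + 1), Nat.choose_succ_succ]
          push_cast
          ring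
      rw [h]
      ring
    rw [key]
    calc _ ≤ ‖1 + z‖ * ‖(1 + z) ^ x - ∑ r ∈ Finset.range (m + 1), (x.choose r : ℂ) * z ^ r‖ +
          x.choose m * ‖z‖ ^ (m + 1) := by
          refine (norm_add_le _ _).trans_eq ?_
          simp
      _ ≤ 1 * (x.choose (m + 1) * ‖z‖ ^ (m + 1)) + x.choose m * ‖z‖ ^ (m + 1) := by gcongr
      _ = _ := by
          rw [Nat.choose_succ_succ]
          push_cast
          ring

/-- With z = e^(it) - 1, E e^(itX) = E (1 + z)^X. Truncating the binomial expansion at m costs at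
most E C(X,m) |z|^m, which tends to (c|z|)^m / m! and is small for large m. -/
theorem tendsto_charFun_of_tendsto_descFactorial {Ω : ℕ → Type*} [∀ n, MeasurableSpace (Ω n)]
    {μ : ∀ n, Measure (Ω n)} [∀ n, IsProbabilityMeasure (μ n)] {X : ∀ n, Ω n → ℕ}
    (hX : ∀ n, Measurable (X n))
    (hint : ∀ n r, Integrable (fun ω => ((X n ω).descFactorial r : ℝ)) (μ n)) {c : NNReal}
    (h : ∀ r, Tendsto (fun n => ∫ ω, ((X n ω).descFactorial r : ℝ) ∂μ n) atTop (𝓝 ((c : ℝ) ^ r)))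
    (t : ℝ) :
    Tendsto (fun n => charFun ((μ n).map fun ω => (X n ω : ℝ)) t) atTop
      (𝓝 (charFun ((poissonMeasure c).map (Nat.cast : ℕ → ℝ)) t)) := by
  rw [charFun_map_cast_poissonMeasure]
  set z : ℂ := Complex.exp (t * Complex.I) - 1 with hz
  have hz1 : 1 + z = Complex.exp (t * Complex.I) := by rw [hz]; ring
  have hz2 : ‖1 + z‖ ≤ 1 := by rw [hz1, Complex.norm_exp_ofReal_mul_I]
  have hdesc : ∀ x r : ℕ, (x.choose r : ℝ) = x.descFactorial r / r.factorial := fun x r => by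
    rw [Nat.descFactorial_eq_factorial_mul_choose]
    push_cast
    field_simp
  have hchoose : ∀ n r, Integrable (fun ω => ((X n ω).choose r : ℝ)) (μ n) := fun n r => by
    have := (hint n r).div_const (r.factorial : ℝ)
    refine this.congr (.of_forall fun ω => ?_)
    exact (hdesc _ _).symm
  have hE : ∀ r, Tendsto (fun n => ∫ ω, ((X n ω).choose r : ℝ) ∂μ n) atTop
      (𝓝 ((c : ℝ) ^ r / r.factorial)) := fun r => by
    refine ((h r).div_const _).congr fun n => ?_
    rw [← integral_div]
    refine integral_congr_ae (.of_forall fun ω => ?_)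
    exact (hdesc _ _).symm
  have hchar : ∀ n, charFun ((μ n).map fun ω => (X n ω : ℝ)) t = ∫ ω, (1 + z) ^ X n ω ∂μ n := by
    intro n
    rw [charFun_apply, integral_map (by fun_prop) (by fun_prop)]
    refine integral_congr_ae (.of_forall fun ω => ?_)
    simp only [hz1, Real.inner_apply]
    rw [← Complex.exp_nat_mul]
    push_cast
    ring_nf
  have hmeas : ∀ n, Integrable (fun ω => (1 + z) ^ X n ω) (μ n) := fun n =>
    Integrable.of_bound (C := 1)
      ((measurable_from_nat (f := fun j : ℕ => (1 + z) ^ j)).comp (hX n)).aestronglyMeasurable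
      (.of_forall fun ω => by
        rw [norm_pow]
        exact pow_le_one₀ (norm_nonneg _) hz2)
  have hbound : ∀ m n, ‖charFun ((μ n).map fun ω => (X n ω : ℝ)) t -
      ∑ r ∈ Finset.range m, ((∫ ω, ((X n ω).choose r : ℝ) ∂μ n : ℝ) : ℂ) * z ^ r‖ ≤
        (∫ ω, ((X n ω).choose m : ℝ) ∂μ n) * ‖z‖ ^ m := by
    intro m n
    have hsum : ∑ r ∈ Finset.range m, ((∫ ω, ((X n ω).choose r : ℝ) ∂μ n : ℝ) : ℂ) * z ^ r =
        ∫ ω, ∑ r ∈ Finset.range m, ((X n ω).choose r : ℂ) * z ^ r ∂μ n := by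
      rw [integral_finsetSum]
      · refine Finset.sum_congr rfl fun r _ => ?_
        rw [integral_mul_const, ← integral_complex_ofReal]
        simp
      · intro r _
        have := ((hchoose n r).ofReal (𝕜 := ℂ)).mul_const (z ^ r)
        simpa using this
    rw [hchar, hsum, ← integral_sub (hmeas n), ← integral_mul_const]
    · refine norm_integral_le_of_norm_le ((hchoose n m).mul_const _) (.of_forall fun ω => ?_)
      exact norm_one_add_pow_sub_sum_choose_le hz2 _ _
    · refine integrable_finsetSum _ fun r _ => ?_
      have := ((hchoose n r).ofReal (𝕜 := ℂ)).mul_const (z ^ r)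
      simpa using this
  have hexp := NormedSpace.expSeries_div_hasSum_exp ((c : ℂ) * z)
  rw [← Complex.exp_eq_exp_ℂ] at hexp
  have htail := (NormedSpace.expSeries_div_hasSum_exp ((c : ℝ) * ‖z‖)).summable.tendsto_atTop_zero
  rw [Metric.tendsto_atTop]
  intro ε hε
  -- The truncation order is fixed before n: both the tail of the series of exp(cz) and the limiting
  -- truncation error fall below ε/3.
  obtain ⟨m, hm1, hm2⟩ := ((hexp.tendsto_sum_nat.eventually
    (Metric.ball_mem_nhds _ (show 0 < ε / 3 by positivity))).and
    (htail.eventually (gt_mem_nhds (show 0 < ε / 3 by positivity)))).exists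
  have hlim1 : Tendsto (fun n => ∑ r ∈ Finset.range m,
      ((∫ ω, ((X n ω).choose r : ℝ) ∂μ n : ℝ) : ℂ) * z ^ r) atTop
      (𝓝 (∑ r ∈ Finset.range m, ((c : ℂ) * z) ^ r / r.factorial)) := by
    refine tendsto_finsetSum _ fun r _ => ?_
    have := ((Complex.continuous_ofReal.tendsto _).comp (hE r)).mul_const (z ^ r)
    rw [mul_pow, mul_div_right_comm]
    simpa using this
  have hlim2 : Tendsto (fun n => (∫ ω, ((X n ω).choose m : ℝ) ∂μ n) * ‖z‖ ^ m) atTop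
      (𝓝 (((c : ℝ) * ‖z‖) ^ m / m.factorial)) := by
    convert (hE m).mul_const (‖z‖ ^ m) using 2
    ring
  obtain ⟨n₁, h₁⟩ := Metric.tendsto_atTop.1 hlim1 (ε / 3) (by positivity)
  obtain ⟨n₂, h₂⟩ := eventually_atTop.1 (hlim2.eventually (gt_mem_nhds hm2))
  refine ⟨max n₁ n₂, fun n hn => ?_⟩
  have e1 := h₁ n (le_of_max_le_left hn)
  have e2 := h₂ n (le_of_max_le_right hn)
  have e3 := hbound m n
  rw [← dist_eq_norm] at e3
  calc dist (charFun ((μ n).map fun ω => (X n ω : ℝ)) t) (Complex.exp ((c : ℂ) * z))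
    _ ≤ _ := dist_triangle4 _ (∑ r ∈ Finset.range m,
        ((∫ ω, ((X n ω).choose r : ℝ) ∂μ n : ℝ) : ℂ) * z ^ r) _ _
    _ < ε / 3 + ε / 3 + ε / 3 := by gcongr; exact e3.trans_lt e2
    _ = ε := by ring

theorem tendstoInDistribution_poisson_of_tendsto_descFactorial {Ω : ℕ → Type*}
    [∀ n, MeasurableSpace (Ω n)] {μ : ∀ n, Measure (Ω n)} [∀ n, IsProbabilityMeasure (μ n)]
    {X : ∀ n, Ω n → ℕ} (hX : ∀ n, Measurable (X n))
    (hint : ∀ n r, Integrable (fun ω => ((X n ω).descFactorial r : ℝ)) (μ n)) {c : NNReal}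
    (h : ∀ r, Tendsto (fun n => ∫ ω, ((X n ω).descFactorial r : ℝ) ∂μ n) atTop
      (𝓝 ((c : ℝ) ^ r))) :
    TendstoInDistribution (fun n ω => (X n ω : ℝ)) atTop (fun j : ℕ => (j : ℝ)) μ
      (poissonMeasure c) where
  forall_aemeasurable n := by have := hX n; fun_prop
  tendsto := ProbabilityMeasure.tendsto_iff_tendsto_charFun.2 fun t =>
    tendsto_charFun_of_tendsto_descFactorial hX hint h t

/-! ### Factorial moments of the number of copies in a random subgraph -/

section Superset

variable {V : Type*} [Finite V]

theorem measurableSet_simpleGraph (S : Set (SimpleGraph V)) : MeasurableSet S :=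
  SimpleGraph.measurableEmbedding_edgeSet.measurableSet_image.1 (Set.toFinite _).measurableSet

theorem setBernoulli_real_superset {ι : Type*} [Finite ι] {u A : Set ι} (p : unitInterval)
    (hA : A ⊆ u) : (setBernoulli u p).real {S | A ⊆ S} = (p : ℝ) ^ A.ncard := by
  classical
  have := Fintype.ofFinite ι
  have h : (fun q : ι → Prop => {i | q i}) ⁻¹' {S | A ⊆ S} =
      Set.univ.pi fun i => if i ∈ A then {True} else Set.univ := by
    ext q
    simp only [Set.mem_preimage, Set.mem_ofPred_eq, Set.mem_pi, Set.mem_univ, forall_const]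
    refine forall_congr' fun i => ?_
    by_cases hi : i ∈ A <;> simp [hi]
  rw [measureReal_def, setBernoulli_apply', h, Measure.infinitePi_eq_pi, Measure.pi_pi,
    ENNReal.toReal_prod]
  have h2 : ∀ i, ((unitInterval.toNNReal p • Measure.dirac (i ∈ u) +
      unitInterval.toNNReal (unitInterval.symm p) • Measure.dirac False)
        (if i ∈ A then {True} else Set.univ : Set Prop)).toReal = if i ∈ A then (p : ℝ) else 1 := by
    intro i
    by_cases hi : i ∈ A
    · simp [hi, hA hi]
    · simp [hi]
  rw [Finset.prod_congr rfl fun i _ => h2 i, Finset.prod_ite]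
  simp [Set.ncard_eq_toFinset_card']

theorem randomSubgraph_real_superset {G : SimpleGraph V} {A : Set (Sym2 V)} (p : unitInterval)
    (hA : A ⊆ G.edgeSet) : (randomSubgraph G p).real {H | A ⊆ H.edgeSet} = (p : ℝ) ^ A.ncard := by
  rw [← setBernoulli_real_superset p hA, measureReal_def, measureReal_def, randomSubgraph,
    SimpleGraph.measurableEmbedding_edgeSet.comap_apply]
  congr 1
  refine measure_congr ?_
  -- Almost every random set lies in `G.edgeSet`, hence has no loops and is the edge set of a graph,
  -- so the comap loses no mass.
  filter_upwards [setBernoulli_ae_subset (u := G.edgeSet) (p := p)] with S hS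
  refine propext ⟨?_, fun h => ?_⟩
  · rintro ⟨H, hH, rfl⟩
    exact hH
  · have h2 : (SimpleGraph.fromEdgeSet S).edgeSet = S := by
      rw [SimpleGraph.edgeSet_fromEdgeSet, sdiff_eq_left, Set.disjoint_left]
      exact fun e he hd => G.not_isDiag_of_mem_edgeSet (hS he) hd
    exact ⟨.fromEdgeSet S, show A ⊆ _ by rw [h2]; exact h, h2⟩

theorem ae_randomSubgraph_le (G : SimpleGraph V) (p : unitInterval) :
    ∀ᵐ H ∂randomSubgraph G p, H.edgeSet ⊆ G.edgeSet := by
  rw [randomSubgraph, ae_iff, SimpleGraph.measurableEmbedding_edgeSet.comap_apply]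
  refine measure_mono_null ?_ (ae_iff.1 (setBernoulli_ae_subset (u := G.edgeSet) (p := p)))
  rintro _ ⟨H, hH, rfl⟩
  exact hH

open Classical in
theorem randomSubgraph_real_superset_eq_ite {G : SimpleGraph V} (A : Set (Sym2 V))
    (p : unitInterval) : (randomSubgraph G p).real {H | A ⊆ H.edgeSet} =
      if A ⊆ G.edgeSet then (p : ℝ) ^ A.ncard else 0 := by
  split_ifs with hA
  · exact randomSubgraph_real_superset p hA
  · rw [measureReal_def, measure_eq_zero_iff_ae_notMem.2, ENNReal.toReal_zero]
    filter_upwards [ae_randomSubgraph_le G p] with H hH hAH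
    exact hA (hAH.trans hH)

end Superset

section Copies

variable {V W : Type*}

/-- The set of edges of the image of `F` under `f`. -/
def edgeImage (F : SimpleGraph W) (f : W → V) : Set (Sym2 V) := Sym2.map f '' F.edgeSet

theorem edgeImage_subset_edgeSet {F : SimpleGraph W} {H : SimpleGraph V} {f : W → V} :
    edgeImage F f ⊆ H.edgeSet ↔ ∀ u v, F.Adj u v → H.Adj (f u) (f v) := by
  refine ⟨fun h u v huv => h ⟨s(u, v), huv, rfl⟩, ?_⟩
  rintro h _ ⟨e, he, rfl⟩
  induction e with | _ u v => exact h u v he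

theorem mk_mem_edgeImage {F : SimpleGraph W} {f : W → V} (hf : Function.Injective f) {u v : W} :
    s(f u, f v) ∈ edgeImage F f ↔ F.Adj u v := by
  rw [edgeImage, ← Sym2.map_mk, (Sym2.map.injective hf).mem_set_image, SimpleGraph.mem_edgeSet]

theorem ncard_edgeImage {F : SimpleGraph W} {f : W → V} (hf : Function.Injective f) :
    (edgeImage F f).ncard = F.edgeSet.ncard :=
  Set.ncard_image_of_injective _ (Sym2.map.injective hf)

/-- Tuples of labelled copies of `F` in the complete graph on `V` with pairwise distinct underlying
unlabelled copies. -/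
def copyTuples (F : SimpleGraph W) (V : Type*) (r : ℕ) : Set (Fin r → W → V) :=
  {g | (∀ i, Function.Injective (g i)) ∧
    Function.Injective fun i => (Set.range (g i), edgeImage F (g i))}

/-- The vertex set is recorded beside the edge set because isolated vertices leave no trace in the
edges. -/
theorem toSubgraph_eq_iff {F : SimpleGraph W} {H : SimpleGraph V} (c d : SimpleGraph.Copy F H) :
    c.toSubgraph = d.toSubgraph ↔
      (Set.range c, edgeImage F c) = (Set.range d, edgeImage F d) := by
  have hv : ∀ c : SimpleGraph.Copy F H, c.toSubgraph.verts = Set.range c := fun c => by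
    simp [SimpleGraph.Copy.toSubgraph]
  have he : ∀ c : SimpleGraph.Copy F H, c.toSubgraph.edgeSet = edgeImage F c := fun c => by
    simp [SimpleGraph.Copy.toSubgraph, edgeImage, SimpleGraph.Subgraph.edgeSet_map]
  rw [Prod.mk.injEq, ← hv, ← hv, ← he, ← he]
  refine ⟨fun h => by rw [h]; exact ⟨rfl, rfl⟩, fun h => ?_⟩
  refine SimpleGraph.Subgraph.ext h.1 ?_
  ext u v
  rw [← SimpleGraph.Subgraph.mem_edgeSet, h.2, SimpleGraph.Subgraph.mem_edgeSet]

/-- Two labelled copies with the same image differ by precomposition with exactly one automorphism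
of F. -/
theorem card_copy_fiber [Finite W] {F : SimpleGraph W} {H : SimpleGraph V}
    (c : SimpleGraph.Copy F H) :
    Nat.card {d : SimpleGraph.Copy F H // d.toSubgraph = c.toSubgraph} = Nat.card (F ≃g F) := by
  refine (Nat.card_eq_of_bijective (fun φ : F ≃g F =>
    (⟨c.comp φ.toCopy, ?_⟩ : {d : SimpleGraph.Copy F H // d.toSubgraph = c.toSubgraph}))
      ⟨?_, ?_⟩).symm
  · rw [toSubgraph_eq_iff, SimpleGraph.Copy.coe_comp]
    refine Prod.ext (φ.surjective.range_comp _) ?_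
    ext e
    constructor
    · rintro ⟨e, he, rfl⟩
      refine ⟨Sym2.map φ e, φ.map_mem_edgeSet_iff.2 he, ?_⟩
      rw [Sym2.map_map]
      rfl
    · rintro ⟨e, he, rfl⟩
      refine ⟨Sym2.map φ.symm e, φ.symm.map_mem_edgeSet_iff.2 he, ?_⟩
      rw [Sym2.map_map]
      congr 1
      ext w
      exact congrArg c (φ.apply_symm_apply w)
  · intro φ ψ h
    ext w
    have h1 := DFunLike.congr_fun (congrArg Subtype.val h) w
    exact c.injective h1
  · rintro ⟨d, hd⟩
    rw [toSubgraph_eq_iff, Prod.mk.injEq] at hd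
    have h1 : ∀ w, ∃ w', c w' = d w := fun w => by
      have : d w ∈ Set.range c := hd.1 ▸ Set.mem_range_self w
      exact this
    choose φ hφ using h1
    have hinj : Function.Injective φ := fun u v h => d.injective (by
      change d u = d v
      rw [← hφ, ← hφ, h])
    have hbij := hinj.bijective_of_finite
    refine ⟨⟨Equiv.ofBijective φ hbij, ?_⟩, ?_⟩
    · intro u v
      change F.Adj (φ u) (φ v) ↔ F.Adj u v
      rw [← mk_mem_edgeImage (f := c) c.injective, ← mk_mem_edgeImage (f := d) d.injective, hφ, hφ,
        hd.2]
    · exact Subtype.ext (SimpleGraph.Copy.ext hφ)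

/-- An ordered r-tuple of distinct unlabelled copies can be labelled in a^r ways. -/
theorem card_aut_pow_mul_descFactorial_copyCount [Fintype V] [Finite W] (F : SimpleGraph W)
    (H : SimpleGraph V) (r : ℕ) :
    Nat.card (F ≃g F) ^ r * (H.copyCount F).descFactorial r =
      Nat.card {g : Fin r → W → V // g ∈ copyTuples F V r ∧ ∀ i, edgeImage F (g i) ⊆ H.edgeSet} := by
  classical
  have := Fintype.ofFinite W
  let S := {H' : H.Subgraph // Nonempty (F ≃g H'.coe)}
  have hS : H.copyCount F = Fintype.card S := by
    rw [SimpleGraph.copyCount, Fintype.card_subtype]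
  have hfib : ∀ s : S, Nat.card {d : SimpleGraph.Copy F H // d.toSubgraph = s.1} =
      Nat.card (F ≃g F) := by
    rintro ⟨H', hH'⟩
    have : H' ∈ Set.range (SimpleGraph.Copy.toSubgraph (A := F) (B := H)) := by
      rw [SimpleGraph.Copy.range_toSubgraph]
      exact hH'
    obtain ⟨c, rfl⟩ := this
    exact card_copy_fiber c
  have hcard : Nat.card (Σ e : Fin r ↪ S, ∀ i, {d : SimpleGraph.Copy F H // d.toSubgraph = (e i).1}) =
      Nat.card (F ≃g F) ^ r * (H.copyCount F).descFactorial r := by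
    rw [Nat.card_sigma]
    simp only [Nat.card_pi, hfib, Finset.prod_const, Finset.card_univ, Fintype.card_fin,
      Finset.sum_const, smul_eq_mul]
    rw [Fintype.card_embedding_eq, hS, Fintype.card_fin, mul_comm]
  rw [← hcard]
  refine Nat.card_eq_of_bijective (fun x => ⟨fun i w => (x.2 i).1 w,
    ⟨fun i => (x.2 i).1.injective, fun i j hij => ?_⟩, fun i => ?_⟩) ⟨?_, ?_⟩
  · have h := (toSubgraph_eq_iff (x.2 i).1 (x.2 j).1).2 hij
    rw [(x.2 i).2, (x.2 j).2] at h
    exact x.1.injective (Subtype.ext h)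
  · exact edgeImage_subset_edgeSet.2 fun u v huv => (x.2 i).1.toHom.map_adj huv
  · rintro ⟨e, x⟩ ⟨e', x'⟩ h
    have h1 : ∀ i, (x i).1 = (x' i).1 := fun i =>
      SimpleGraph.Copy.ext fun w => congrFun (congrFun (congrArg Subtype.val h) i) w
    have h2 : e = e' := by
      ext1 i
      rw [← Subtype.coe_inj, ← (x i).2, ← (x' i).2, h1]
    subst h2
    congr
    funext i
    exact Subtype.ext (h1 i)
  · rintro ⟨g, ⟨hinj, hdist⟩, hg⟩
    let d : Fin r → SimpleGraph.Copy F H := fun i =>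
      ⟨⟨g i, fun {u v} huv => edgeImage_subset_edgeSet.1 (hg i) u v huv⟩, hinj i⟩
    refine ⟨⟨⟨fun i => ⟨(d i).toSubgraph, ⟨(d i).isoToSubgraph⟩⟩, fun i j hij => hdist ?_⟩,
      fun i => ⟨d i, rfl⟩⟩, rfl⟩
    exact (toSubgraph_eq_iff (d i) (d j)).1 (congrArg Subtype.val hij)

theorem integral_descFactorial_copyCount [Fintype V] [Finite W] (F : SimpleGraph W)
    (G : SimpleGraph V) (p : unitInterval) (r : ℕ) [DecidablePred fun g : Fin r → W → V =>
      g ∈ copyTuples F V r ∧ ∀ i, edgeImage F (g i) ⊆ G.edgeSet] [Fintype (Fin r → W → V)] :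
    (Nat.card (F ≃g F) : ℝ) ^ r * ∫ H, ((H.copyCount F).descFactorial r : ℝ) ∂randomSubgraph G p =
      ∑ g : Fin r → W → V with g ∈ copyTuples F V r ∧ ∀ i, edgeImage F (g i) ⊆ G.edgeSet,
        (p : ℝ) ^ (⋃ i, edgeImage F (g i)).ncard := by
  classical
  have h1 : ∀ H : SimpleGraph V, (Nat.card (F ≃g F) : ℝ) ^ r * (H.copyCount F).descFactorial r =
      ∑ g : Fin r → W → V with g ∈ copyTuples F V r,
        Set.indicator {H | ⋃ i, edgeImage F (g i) ⊆ H.edgeSet} (fun _ => (1 : ℝ)) H := by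
    intro H
    have h2 := card_aut_pow_mul_descFactorial_copyCount F H r
    rw [Nat.card_eq_fintype_card (α := {g : Fin r → W → V // _}), Fintype.card_subtype] at h2
    simp only [Set.indicator_apply, Set.mem_ofPred_eq, Set.iUnion_subset_iff]
    rw [Finset.sum_boole, Finset.filter_filter, ← h2]
    push_cast
    rfl
  rw [← integral_const_mul]
  simp only [h1]
  rw [integral_finsetSum]
  · simp only [integral_indicator (measurableSet_simpleGraph _), integral_const,
      measureReal_restrict_apply_univ, smul_eq_mul, mul_one]
    simp only [randomSubgraph_real_superset_eq_ite]
    simp only [Set.iUnion_subset_iff]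
    rw [← Finset.sum_filter, Finset.filter_filter]
    congr
  · exact fun g _ => (integrable_const _).indicator (measurableSet_simpleGraph _)

end Copies

/-! ### Unions of copies of a strictly balanced graph -/

theorem ncard_range_of_injective {V W : Type*} {f : W → V} (hf : Function.Injective f) :
    (Set.range f).ncard = Nat.card W := by
  rw [← Set.image_univ, Set.ncard_image_of_injective _ hf, Set.ncard_univ]

theorem mem_range_of_mem_edgeImage {V W : Type*} {F : SimpleGraph W} {f : W → V} {e : Sym2 V} (he : e ∈ edgeImage F f)
    {v : V} (hv : v ∈ e) : v ∈ Set.range f := by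
  obtain ⟨e, -, rfl⟩ := he
  obtain ⟨w, -, rfl⟩ := Sym2.mem_map.1 hv
  exact ⟨w, rfl⟩

theorem mem_copyTuples_of_injective {V W : Type*} {F : SimpleGraph W} [Nonempty W] {r : ℕ}
    {g : Fin r → W → V}
    (hg : Function.Injective fun x : Fin r × W => g x.1 x.2) : g ∈ copyTuples F V r := by
  refine ⟨fun i u v h => (Prod.ext_iff.1 (@hg (i, u) (i, v) h)).2, fun i j h => ?_⟩
  obtain ⟨w⟩ := ‹Nonempty W›
  have h1 : g i w ∈ Set.range (g j) := by
    rw [← show Set.range (g i) = Set.range (g j) from (Prod.ext_iff.1 h).1]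
    exact Set.mem_range_self w
  obtain ⟨w', hw'⟩ := h1
  exact (Prod.ext_iff.1 (@hg (i, w) (j, w') hw'.symm)).1

section Balanced

variable {V W : Type*} [Finite W] {F : SimpleGraph W}

/-- The part of the copy inside `(U, E)` pulls back to a subgraph of F, to which strict balance
applies. Equality is left only for an empty intersection or a copy wholly contained. -/
theorem IsStrictlyBalanced.ncard_inter (hF : IsStrictlyBalanced F) {f : W → V}
    (hf : Function.Injective f) {U : Set V} {E : Set (Sym2 V)} (hE : ∀ e ∈ E, ∀ v ∈ e, v ∈ U) :
    Nat.card W * (edgeImage F f ∩ E).ncard ≤ F.edgeSet.ncard * (Set.range f ∩ U).ncard ∧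
      ((Set.range f ∩ U).Nonempty → ¬(Set.range f ⊆ U ∧ edgeImage F f ⊆ E) →
        Nat.card W * (edgeImage F f ∩ E).ncard < F.edgeSet.ncard * (Set.range f ∩ U).ncard) := by
  let H : F.Subgraph :=
    { verts := f ⁻¹' U
      Adj := fun u v => F.Adj u v ∧ s(f u, f v) ∈ E
      adj_sub := fun h => h.1
      edge_vert := fun h => hE _ h.2 _ (Sym2.mem_mk_left _ _)
      symm := ⟨fun u v h => ⟨h.1.symm, by rw [Sym2.eq_swap]; exact h.2⟩⟩ }
  have hv : (Set.range f ∩ U).ncard = H.verts.ncard := by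
    rw [← Set.image_preimage_eq_range_inter, Set.ncard_image_of_injective _ hf]
  have he : (edgeImage F f ∩ E).ncard = H.edgeSet.ncard := by
    rw [edgeImage, ← Set.image_inter_preimage,
      Set.ncard_image_of_injective _ (Sym2.map.injective hf)]
    congr 1
    ext e
    induction e with | _ u v => rfl
  have hlt : (Set.range f ∩ U).Nonempty → ¬(Set.range f ⊆ U ∧ edgeImage F f ⊆ E) →
      Nat.card W * (edgeImage F f ∩ E).ncard < F.edgeSet.ncard * (Set.range f ∩ U).ncard := by
    rintro ⟨_, ⟨w, rfl⟩, hw⟩ hne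
    have hH : H ≠ ⊤ := by
      intro h
      refine hne ⟨?_, ?_⟩
      · rintro _ ⟨u, rfl⟩
        have : u ∈ H.verts := by rw [h]; trivial
        exact this
      · rintro _ ⟨e, he, rfl⟩
        induction e with
        | _ u v =>
          have : H.Adj u v := by rw [h]; exact he
          exact this.2
    have h := hF H hH ⟨w, hw⟩
    have : Nonempty W := ⟨w⟩
    have hpos : 0 < H.verts.ncard := (Set.ncard_pos (Set.toFinite _)).2 ⟨w, hw⟩
    rw [hv, he]
    rw [div_lt_div_iff₀ (by exact_mod_cast hpos) (by exact_mod_cast Nat.card_pos)] at h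
    rw [mul_comm]
    exact_mod_cast h
  refine ⟨?_, hlt⟩
  by_cases h1 : (Set.range f ∩ U).Nonempty
  · by_cases h2 : Set.range f ⊆ U ∧ edgeImage F f ⊆ E
    · rw [Set.inter_eq_left.2 h2.1, Set.inter_eq_left.2 h2.2, ncard_edgeImage hf, mul_comm,
        ← Set.image_univ, Set.ncard_image_of_injective _ hf, Set.ncard_univ]
    · exact (hlt h1 h2).le
  · have : (edgeImage F f ∩ E) = ∅ := by
      rw [Set.eq_empty_iff_forall_notMem]
      rintro _ ⟨⟨e, he, rfl⟩, h2⟩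
      induction e with
      | _ u v => exact h1 ⟨f u, ⟨u, rfl⟩, hE _ h2 _ (Sym2.mem_mk_left _ _)⟩
    simp [this]

/-- Inclusion-exclusion for the excess k e - l v: a full copy has excess 0 and its intersection with
`(U, E)` has excess at most 0, so adding the copy preserves the lower bound `s`. -/
theorem IsStrictlyBalanced.ncard_union (hF : IsStrictlyBalanced F) {f : W → V}
    (hf : Function.Injective f) {U : Set V} {E : Set (Sym2 V)} (hE : ∀ e ∈ E, ∀ v ∈ e, v ∈ U)
    (hU : U.Finite) (hE' : E.Finite) {s : ℕ}
    (h : F.edgeSet.ncard * U.ncard + s ≤ Nat.card W * E.ncard) :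
    F.edgeSet.ncard * (Set.range f ∪ U).ncard + s ≤ Nat.card W * (edgeImage F f ∪ E).ncard ∧
      ((Set.range f ∩ U).Nonempty → ¬(Set.range f ⊆ U ∧ edgeImage F f ⊆ E) →
        F.edgeSet.ncard * (Set.range f ∪ U).ncard + s <
          Nat.card W * (edgeImage F f ∪ E).ncard) := by
  have h1 := Set.ncard_union_add_ncard_inter (Set.range f) U (Set.toFinite _) hU
  have h2 := Set.ncard_union_add_ncard_inter (edgeImage F f) E
    ((Set.toFinite F.edgeSet).image _) hE'
  rw [ncard_range_of_injective hf] at h1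
  rw [ncard_edgeImage hf] at h2
  have h3 := congrArg (F.edgeSet.ncard * ·) h1
  have h4 := congrArg (Nat.card W * ·) h2
  simp only [mul_add] at h3 h4
  have h5 := mul_comm (Nat.card W) F.edgeSet.ncard
  obtain ⟨h6, h7⟩ := hF.ncard_inter hf hE
  refine ⟨by omega, fun a b => ?_⟩
  have := h7 a b
  omega

/-- Start from the two meeting copies, whose union has positive excess because they are distinct;
further copies cannot lower the bound. -/
theorem IsStrictlyBalanced.ncard_iUnion_lt (hF : IsStrictlyBalanced F) {r : ℕ}
    {g : Fin r → W → V} (hg : g ∈ copyTuples F V r) {i j : Fin r} (hij : i ≠ j)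
    (hmeet : (Set.range (g i) ∩ Set.range (g j)).Nonempty) :
    F.edgeSet.ncard * (⋃ i, Set.range (g i)).ncard < Nat.card W * (⋃ i, edgeImage F (g i)).ncard := by
  have hfin : ∀ i, (edgeImage F (g i)).Finite := fun i => (Set.toFinite F.edgeSet).image _
  have key : ∀ T : Finset (Fin r),
      F.edgeSet.ncard * ((⋃ i ∈ T, Set.range (g i)) ∪ (Set.range (g i) ∪ Set.range (g j))).ncard <
        Nat.card W *
          ((⋃ i ∈ T, edgeImage F (g i)) ∪ (edgeImage F (g i) ∪ edgeImage F (g j))).ncard := by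
    intro T
    induction T using Finset.induction_on with
    | empty =>
      simp only [Finset.notMem_empty, Set.iUnion_of_empty, Set.iUnion_empty, Set.empty_union]
      refine (hF.ncard_union (hg.1 i) (fun e he v hv => mem_range_of_mem_edgeImage he hv)
        (Set.toFinite _) (hfin j) (s := 0) ?_).2 hmeet fun h => hij (hg.2 ?_)
      · rw [ncard_range_of_injective (hg.1 j), ncard_edgeImage (hg.1 j), mul_comm, add_zero]
      -- Containment of one copy in the other would force equality, as the cardinalities agree.
      · refine Prod.ext (Set.eq_of_subset_of_ncard_le h.1 ?_ (Set.toFinite _))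
          (Set.eq_of_subset_of_ncard_le h.2 ?_ (hfin j))
        · rw [ncard_range_of_injective (hg.1 i), ncard_range_of_injective (hg.1 j)]
        · rw [ncard_edgeImage (hg.1 i), ncard_edgeImage (hg.1 j)]
    | insert m T _ ih =>
      rw [Finset.set_biUnion_insert, Finset.set_biUnion_insert, Set.union_assoc, Set.union_assoc]
      -- Here `s = 1` encodes the strict inequality in the naturals.
      refine (hF.ncard_union (hg.1 m) ?_ ?_ ?_ (s := 1) ih).1
      · rintro e (he | he | he) v hv
        · simp only [Set.mem_iUnion] at he
          obtain ⟨a, ha, he⟩ := he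
          exact Or.inl (Set.mem_biUnion ha (mem_range_of_mem_edgeImage he hv))
        · exact Or.inr (Or.inl (mem_range_of_mem_edgeImage he hv))
        · exact Or.inr (Or.inr (mem_range_of_mem_edgeImage he hv))
      · exact (T.finite_toSet.biUnion fun a _ => Set.toFinite _).union
          ((Set.toFinite _).union (Set.toFinite _))
      · exact (T.finite_toSet.biUnion fun a _ => hfin a).union ((hfin i).union (hfin j))
  have := key Finset.univ
  simp only [Finset.mem_univ, Set.iUnion_true] at this
  rwa [Set.union_eq_left.2, Set.union_eq_left.2] at this
  · exact Set.union_subset (Set.subset_iUnion (fun i => edgeImage F (g i)) i)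
      (Set.subset_iUnion (fun i => edgeImage F (g i)) j)
  · exact Set.union_subset (Set.subset_iUnion (fun i => Set.range (g i)) i)
      (Set.subset_iUnion (fun i => Set.range (g i)) j)

theorem ncard_iUnion_edgeImage_of_injective {r : ℕ} {g : Fin r → W → V}
    (hg : Function.Injective fun x : Fin r × W => g x.1 x.2) :
    (⋃ i, edgeImage F (g i)).ncard = r * F.edgeSet.ncard := by
  have hinj : ∀ i, Function.Injective (g i) :=
    fun i u v h => (Prod.ext_iff.1 (@hg (i, u) (i, v) h)).2
  have hdisj : Pairwise (Function.onFun Disjoint fun i => edgeImage F (g i)) := by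
    intro i j hij
    rw [Function.onFun, Set.disjoint_left]
    rintro e hi hj
    induction e with
    | _ u v =>
      obtain ⟨a, ha⟩ := mem_range_of_mem_edgeImage hi (Sym2.mem_mk_left u v)
      obtain ⟨b, hb⟩ := mem_range_of_mem_edgeImage hj (Sym2.mem_mk_left u v)
      exact hij (Prod.ext_iff.1 (@hg (i, a) (j, b) (ha.trans hb.symm))).1
  have hfin : ∀ i, (edgeImage F (g i)).Finite := fun i => (Set.toFinite F.edgeSet).image _
  rw [Set.ncard_iUnion_of_finite hfin hdisj]
  simp [finsum_eq_sum_of_fintype, ncard_edgeImage (hinj _)]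

theorem IsStrictlyBalanced.ncard_iUnion_lt_of_not_injective (hF : IsStrictlyBalanced F) {r : ℕ}
    {g : Fin r → W → V} (hg : g ∈ copyTuples F V r)
    (hninj : ¬Function.Injective fun x : Fin r × W => g x.1 x.2) :
    F.edgeSet.ncard * (Set.range fun x : Fin r × W => g x.1 x.2).ncard <
      Nat.card W * (⋃ i, edgeImage F (g i)).ncard := by
  have hr : (Set.range fun x : Fin r × W => g x.1 x.2) = ⋃ i, Set.range (g i) := by
    ext v
    simp
  rw [Function.not_injective_iff] at hninj
  obtain ⟨⟨i, u⟩, ⟨j, v⟩, h, hne⟩ := hninj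
  have hij : i ≠ j := by
    rintro rfl
    exact hne (Prod.ext rfl (hg.1 i h))
  rw [hr]
  exact hF.ncard_iUnion_lt hg hij ⟨g i u, ⟨u, rfl⟩, ⟨v, h.symm⟩⟩

end Balanced

/-- A map with an image of size v factors through `Fin v`. -/
theorem card_ncard_range_eq_le {α V : Type*} [Fintype α] [Fintype V] [Fintype (α → V)] (v : ℕ)
    [DecidablePred fun g : α → V => (Set.range g).ncard = v] :
    (Finset.univ.filter fun g : α → V => (Set.range g).ncard = v).card ≤
      v ^ Fintype.card α * Fintype.card V ^ v := by
  classical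
  have h : (Finset.univ.filter fun g : α → V => (Set.range g).ncard = v) ⊆
      (Finset.univ : Finset ((α → Fin v) × (Fin v → V))).image fun x => x.2 ∘ x.1 := by
    intro g hg
    rw [Finset.mem_filter] at hg
    have hc : Nat.card (Set.range g) = v := by rw [Nat.card_coe_set_eq, hg.2]
    let e : Set.range g ≃ Fin v := Finite.equivFinOfCardEq hc
    refine Finset.mem_image.2 ⟨(fun a => e ⟨g a, a, rfl⟩, fun i => (e.symm i).1), Finset.mem_univ _, ?_⟩
    ext a
    simp
  refine (Finset.card_le_card h).trans (Finset.card_image_le.trans_eq ?_)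
  simp

/-! ### The Poisson limit in a sequence of random subgraphs -/

/-- The number of labelled copies of `F` in `G`. -/
noncomputable def labelledCount {V W : Type*} (F : SimpleGraph W) (G : SimpleGraph V) : ℕ :=
  {f : W → V | Function.Injective f ∧ edgeImage F f ⊆ G.edgeSet}.ncard

/-- A bound for the contribution of the non-disjoint `r`-tuples of copies of a strictly balanced
graph with `k` vertices and `l` edges to the `r`-th factorial moment. -/
noncomputable def overlapBound (k l r N : ℕ) (p : ℝ) : ℝ :=
  ∑ v ∈ Finset.range (r * k + 1),
    (v : ℝ) ^ (r * k) * ((N : ℝ) ^ v * p ^ (((v * l + 1 : ℕ) : ℝ) / k))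

/-- Both quantities are sums over r-tuples of labelled copies in G. Disjoint tuples cancel; any
other tuple covering v vertices has both its terms at most p^((vl+1)/k). The tuples are then counted
by v as arbitrary maps, ignoring G. -/
theorem abs_moment_sub_le {V W : Type*} [Fintype V] [Finite W] {F : SimpleGraph W}
    (hF : IsStrictlyBalanced F) (hl : 0 < F.edgeSet.ncard) (G : SimpleGraph V) (p : unitInterval)
    (r : ℕ) :
    |(Nat.card (F ≃g F) : ℝ) ^ r * ∫ H, ((H.copyCount F).descFactorial r : ℝ) ∂randomSubgraph G p -
      (labelledCount F G * (p : ℝ) ^ F.edgeSet.ncard) ^ r| ≤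
        overlapBound (Nat.card W) F.edgeSet.ncard r (Fintype.card V) p := by
  classical
  have := Fintype.ofFinite W
  set k := Nat.card W with hk
  set l := F.edgeSet.ncard with hl'
  have hW : Nonempty W := by
    obtain ⟨e, -⟩ := Set.nonempty_of_ncard_ne_zero hl.ne'
    induction e with | _ u v => exact ⟨u⟩
  have hkpos : 0 < k := Nat.card_pos
  have hp0 : (0 : ℝ) ≤ p := p.2.1
  have hp1 : (p : ℝ) ≤ 1 := p.2.2
  let S : Finset (W → V) := {f | Function.Injective f ∧ edgeImage F f ⊆ G.edgeSet}
  have hS : labelledCount F G = S.card := by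
    rw [labelledCount, Set.ncard_eq_toFinset_card']
    congr 1
    ext f
    simp [S]
  let img : (Fin r → W → V) → ℕ := fun g => (Set.range fun x : Fin r × W => g x.1 x.2).ncard
  let b : ℕ → ℝ := fun v => (p : ℝ) ^ (((v * l + 1 : ℕ) : ℝ) / k)
  have hb0 : ∀ v, 0 ≤ b v := fun v => Real.rpow_nonneg hp0 _
  have himg : ∀ g, img g ≤ r * k := fun g => by
    have := Set.ncard_image_le (Set.finite_univ (α := Fin r × W)) (f := fun x => g x.1 x.2)
    rw [Set.image_univ, Set.ncard_univ, Nat.card_prod, Nat.card_fin] at this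
    exact this
  have himg' : ∀ g, (¬Function.Injective fun x : Fin r × W => g x.1 x.2) → img g < r * k := by
    intro g hg
    refine lt_of_le_of_ne (himg g) fun h => hg ?_
    rw [← Set.injOn_univ, ← Set.ncard_image_iff Set.finite_univ, Set.image_univ, Set.ncard_univ,
      Nat.card_prod, Nat.card_fin]
    exact h
  have hpow : ∀ {v e : ℕ}, v * l + 1 ≤ k * e → (p : ℝ) ^ e ≤ b v := by
    intro v e h
    rw [← Real.rpow_natCast]
    refine Real.rpow_le_rpow_of_exponent_ge' hp0 hp1 (by positivity) ?_
    rw [div_le_iff₀ (by exact_mod_cast hkpos), mul_comm (e : ℝ)]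
    exact_mod_cast h
  have hmain : (labelledCount F G * (p : ℝ) ^ l) ^ r =
      ∑ g ∈ Fintype.piFinset fun _ : Fin r => S, (p : ℝ) ^ (r * l) := by
    rw [Finset.sum_const, Fintype.card_piFinset, hS]
    simp only [Finset.prod_const, Finset.card_univ, Fintype.card_fin, nsmul_eq_mul]
    push_cast
    rw [mul_pow, ← pow_mul, mul_comm l]
  have hmom : (Nat.card (F ≃g F) : ℝ) ^ r *
      ∫ H, ((H.copyCount F).descFactorial r : ℝ) ∂randomSubgraph G p =
        ∑ g ∈ Fintype.piFinset fun _ : Fin r => S,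
          if g ∈ copyTuples F V r then (p : ℝ) ^ (⋃ i, edgeImage F (g i)).ncard else 0 := by
    rw [integral_descFactorial_copyCount, ← Finset.sum_filter]
    refine Finset.sum_congr ?_ fun _ _ => rfl
    ext g
    simp only [Finset.mem_filter, Finset.mem_univ, true_and, Fintype.mem_piFinset, S]
    exact ⟨fun h => ⟨fun i => ⟨h.1.1 i, h.2 i⟩, h.1⟩, fun h => ⟨h.2, fun i => (h.1 i).2⟩⟩
  rw [hmom, hmain, ← Finset.sum_sub_distrib]
  refine (Finset.abs_sum_le_sum_abs _ _).trans ?_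
  calc _ ≤ ∑ g ∈ Fintype.piFinset fun _ : Fin r => S, b (img g) := ?_
    _ ≤ ∑ g : Fin r → W → V, b (img g) :=
      Finset.sum_le_sum_of_subset_of_nonneg (Finset.subset_univ _) fun g _ _ => hb0 _
    _ = ∑ v ∈ Finset.range (r * k + 1), ∑ g : Fin r → W → V with img g = v, b (img g) :=
      (Finset.sum_fiberwise_of_maps_to
        (fun g _ => Finset.mem_range.2 (Nat.lt_succ_of_le (himg g))) _).symm
    _ ≤ _ := Finset.sum_le_sum fun v _ => ?_
  · refine Finset.sum_le_sum fun g hg => ?_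
    by_cases hinj : Function.Injective fun x : Fin r × W => g x.1 x.2
    · rw [if_pos (mem_copyTuples_of_injective hinj), ncard_iUnion_edgeImage_of_injective hinj,
        sub_self, abs_zero]
      exact hb0 _
    -- At least one of the rk possible vertices is lost, which frees l ≥ 1 in the exponent of the
    -- main term as well.
    · have h1 : (p : ℝ) ^ (r * l) ≤ b (img g) := hpow (by
        have h2 := himg' g hinj
        calc img g * l + 1 ≤ img g * l + l := by omega
          _ = (img g + 1) * l := by ring
          _ ≤ (r * k) * l := by gcongr; omega
          _ = k * (r * l) := by ring)
      split_ifs with hct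
      · have h3 : (p : ℝ) ^ (⋃ i, edgeImage F (g i)).ncard ≤ b (img g) := hpow (by
          have := hF.ncard_iUnion_lt_of_not_injective hct hinj
          rw [mul_comm (img g)]
          exact this)
        exact abs_sub_le_of_nonneg_of_le (by positivity) h3 (by positivity) h1
      · rw [zero_sub, abs_neg, abs_of_nonneg (by positivity)]
        exact h1
  · rw [Finset.sum_congr rfl fun g hg => by rw [(Finset.mem_filter.1 hg).2], Finset.sum_const,
      nsmul_eq_mul, ← mul_assoc]
    refine mul_le_mul_of_nonneg_right ?_ (hb0 v)
    have h1 : (Finset.univ.filter fun g : Fin r → W → V => img g = v).card =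
        (Finset.univ.filter fun g : Fin r × W → V => (Set.range g).ncard = v).card := by
      refine Finset.card_equiv (Equiv.curry (Fin r) W V).symm fun g => ?_
      simp only [Finset.mem_filter, Finset.mem_univ, true_and]
      rfl
    rw [h1]
    have h2 := card_ncard_range_eq_le (α := Fin r × W) (V := V) v
    rw [Fintype.card_prod, Fintype.card_fin, ← Nat.card_eq_fintype_card (α := W), ← hk] at h2
    exact_mod_cast h2

theorem tendstoInDistribution_copyCount {W : Type*} [Finite W] {F : SimpleGraph W}
    (hF : IsStrictlyBalanced F) (hl : 0 < F.edgeSet.ncard) {V : ℕ → Type*} [∀ n, Fintype (V n)]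
    (G : ∀ n, SimpleGraph (V n)) (p : ℕ → unitInterval) {c : ℝ}
    (hmain : Tendsto (fun n => labelledCount F (G n) * (p n : ℝ) ^ F.edgeSet.ncard) atTop (𝓝 c))
    (hsmall : ∀ v : ℕ, Tendsto (fun n => (Fintype.card (V n) : ℝ) ^ v *
      (p n : ℝ) ^ (((v * F.edgeSet.ncard + 1 : ℕ) : ℝ) / (Nat.card W : ℕ))) atTop (𝓝 0)) :
    TendstoInDistribution (fun (n : ℕ) (H : SimpleGraph (V n)) => (H.copyCount F : ℝ)) atTop
      (fun j : ℕ => (j : ℝ)) (fun n => randomSubgraph (G n) (p n))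
      (poissonMeasure (Real.toNNReal (c / (Nat.card (F ≃g F) : ℝ)))) := by
  have : Finite (F ≃g F) := Finite.of_injective (fun φ : F ≃g F => (φ : W → W)) DFunLike.coe_injective
  have ha : (0 : ℝ) < Nat.card (F ≃g F) := by
    have : Nonempty (F ≃g F) := ⟨RelIso.refl _⟩
    exact_mod_cast Nat.card_pos
  have hc : 0 ≤ c := ge_of_tendsto' hmain fun n => by
    have := (p n).2.1
    positivity
  refine tendstoInDistribution_poisson_of_tendsto_descFactorial
    (X := fun n (H : SimpleGraph (V n)) => H.copyCount F)
    (fun n s _ => measurableSet_simpleGraph _) (fun n r => ?_) fun r => ?_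
  · have : MeasurableSingletonClass (SimpleGraph (V n)) := ⟨fun _ => measurableSet_simpleGraph _⟩
    exact Integrable.of_finite
  rw [Real.coe_toNNReal _ (by positivity), div_pow]
  have h0 : Tendsto (fun n => overlapBound (Nat.card W) F.edgeSet.ncard r (Fintype.card (V n)) (p n))
      atTop (𝓝 0) := by
    have : Tendsto (fun n => overlapBound (Nat.card W) F.edgeSet.ncard r (Fintype.card (V n)) (p n))
        atTop (𝓝 (∑ v ∈ Finset.range (r * Nat.card W + 1), (v : ℝ) ^ (r * Nat.card W) * 0)) :=
      tendsto_finsetSum _ fun v _ => (hsmall v).const_mul _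
    simpa using this
  have h1 := squeeze_zero_norm 
    (fun n => (Real.norm_eq_abs _).trans_le (abs_moment_sub_le hF hl (G n) (p n) r)) h0
  have h2 := (h1.add (hmain.pow r)).div_const ((Nat.card (F ≃g F) : ℝ) ^ r)
  rw [zero_add] at h2
  refine h2.congr fun n => ?_
  rw [sub_add_cancel, mul_div_cancel_left₀ _ (by positivity)]

/-! ### Walsh functions on the cube -/

section Walsh

/-- The sign `±1` encoded by a bit. -/
def bitSign (b : Fin 2) : ℝ := 2 * (b : ℕ) - 1

theorem bitSign_mul_self (b : Fin 2) : bitSign b * bitSign b = 1 := by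
  fin_cases b <;> norm_num [bitSign]

theorem sum_bitSign : ∑ b, bitSign b = 0 := by
  norm_num [bitSign, Fin.sum_univ_two]

variable {W : Type*}

/-- The Walsh function of a set of coordinates. -/
def walsh (S : Finset W) (ω : W → Fin 2) : ℝ := ∏ w ∈ S, bitSign (ω w)

theorem walsh_mul_self (S : Finset W) (ω : W → Fin 2) : walsh S ω * walsh S ω = 1 := by
  simp [walsh, ← Finset.prod_mul_distrib, bitSign_mul_self]

variable [Fintype W] [DecidableEq W]

/-- The sum factors over the coordinates, and the factor at `w` is (-1) + 1 = 0. -/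
theorem sum_walsh_mul_of_mem {S T : Finset W} {w : W} (hS : w ∈ S) (hT : w ∉ T) :
    ∑ ω, walsh S ω * walsh T ω = 0 := by
  have h : ∀ ω : W → Fin 2, walsh S ω * walsh T ω =
      ∏ v, (if v ∈ S then bitSign (ω v) else 1) * (if v ∈ T then bitSign (ω v) else 1) := by
    intro ω
    rw [Finset.prod_mul_distrib]
    simp [walsh, Finset.prod_ite_mem]
  simp only [h]
  rw [← Fintype.prod_sum fun (v : W) (b : Fin 2) =>
    (if v ∈ S then bitSign b else 1) * (if v ∈ T then bitSign b else 1)]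
  refine Finset.prod_eq_zero (Finset.mem_univ w) ?_
  simpa [hS, hT] using sum_bitSign

theorem sum_walsh_mul_of_ne {S T : Finset W} (h : S ≠ T) : ∑ ω, walsh S ω * walsh T ω = 0 := by
  by_cases hST : S ⊆ T
  · obtain ⟨w, hT, hS⟩ := Finset.not_subset.1 fun h' => h (hST.antisymm h')
    simp only [mul_comm (walsh S _)]
    exact sum_walsh_mul_of_mem hT hS
  · obtain ⟨w, hS, hT⟩ := Finset.not_subset.1 hST
    exact sum_walsh_mul_of_mem hS hT

theorem sum_walsh {S : Finset W} (h : S.Nonempty) : ∑ ω, walsh S ω = 0 := by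
  have := sum_walsh_mul_of_ne h.ne_empty
  simpa [walsh] using this

theorem sum_sq_sum_walsh {ι : Type*} [Fintype ι] {S : ι → Finset W}
    (hS : Function.Injective S) (a : ι → ℝ) :
    ∑ ω, (∑ i, a i * walsh (S i) ω) ^ 2 = 2 ^ Fintype.card W * ∑ i, a i ^ 2 := by
  classical
  have h : ∀ i j, ∑ ω, (a i * walsh (S i) ω) * (a j * walsh (S j) ω) =
      if i = j then 2 ^ Fintype.card W * a i ^ 2 else 0 := by
    intro i j
    have h1 : ∀ ω, (a i * walsh (S i) ω) * (a j * walsh (S j) ω) =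
        a i * a j * (walsh (S i) ω * walsh (S j) ω) := fun ω => by ring
    simp only [h1, ← Finset.mul_sum]
    split_ifs with hij
    · subst hij
      simp [walsh_mul_self]
      ring
    · rw [sum_walsh_mul_of_ne fun h => hij (hS h), mul_zero]
  simp only [sq, Finset.sum_mul_sum]
  rw [Finset.sum_comm]
  simp only [Finset.sum_comm (s := (Finset.univ : Finset (W → Fin 2))), h]
  simp [Finset.mul_sum, sq]

end Walsh

/-! ### Deviations of the weights and scalar products -/

section Deviation

variable {W : Type*} {F : SimpleGraph W}

/-- The product of the bits of `ω` at the ends of `e`. -/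
def edgeProd (ω : W → Fin 2) (e : Sym2 W) : ℕ :=
  Sym2.lift ⟨fun u v => (ω u : ℕ) * (ω v : ℕ), fun _ _ => mul_comm _ _⟩ e

@[simp]
theorem edgeProd_mk (ω : W → Fin 2) (u v : W) : edgeProd ω s(u, v) = (ω u : ℕ) * (ω v : ℕ) := rfl

/-- The deviations of the bits and of the products of bits along the edges of `F` from their means. -/
noncomputable def deviation (F : SimpleGraph W) (ω : W → Fin 2) : W ⊕ F.edgeSet → ℝ :=
  Sum.elim (fun w => (ω w : ℕ) - 1 / 2) fun e => edgeProd ω e - 1 / 4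

/-- The set of coordinates indexing the leading Walsh function of a deviation. -/
def walshIndex [DecidableEq W] (F : SimpleGraph W) : W ⊕ F.edgeSet → Finset W :=
  Sum.elim (fun w => {w}) fun e => e.1.toFinset

theorem walshIndex_injective [DecidableEq W] : Function.Injective (walshIndex F) := by
  have hcard : ∀ e : F.edgeSet, e.1.toFinset.card = 2 := fun e =>
    Sym2.card_toFinset_of_not_isDiag _ (F.not_isDiag_of_mem_edgeSet e.2)
  rintro (u | e) (v | e') h
  · exact congrArg _ (Finset.singleton_injective h)
  · have := congrArg Finset.card h
    simp [walshIndex, hcard] at this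
  · have := congrArg Finset.card h
    simp [walshIndex, hcard] at this
  · congr 1
    refine Subtype.ext (Sym2.ext fun w => ?_)
    rw [← Sym2.mem_toFinset, ← Sym2.mem_toFinset]
    exact (Finset.ext_iff.1 h) w

theorem walshIndex_nonempty [DecidableEq W] (d : W ⊕ F.edgeSet) : (walshIndex F d).Nonempty := by
  rcases d with w | e
  · exact Finset.singleton_nonempty w
  · exact Finset.nonempty_iff_ne_empty.2 (Sym2.toFinset_ne_empty _)

/-- For bits x = (1 + s)/2 with signs s, x_u x_v - 1/4 = (s_u s_v + s_u + s_v)/4. -/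
theorem edgeProd_sub_eq [Fintype W] [DecidableEq W] (ω : W → Fin 2) {e : Sym2 W} (he : ¬e.IsDiag) :
    (edgeProd ω e : ℝ) - 1 / 4 =
      (walsh e.toFinset ω + ∑ w, if w ∈ e then bitSign (ω w) else 0) / 4 := by
  induction e with
  | _ u v =>
    have huv : u ≠ v := he
    have h1 : ∑ w, (if w ∈ s(u, v) then bitSign (ω w) else 0) = bitSign (ω u) + bitSign (ω v) := by
      rw [← Finset.sum_filter, ← Finset.sum_pair (f := fun w => bitSign (ω w)) huv]
      congr 1
      ext w
      simp
    rw [h1, Sym2.toFinset_mk_eq, walsh, Finset.prod_pair huv]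
    simp only [edgeProd_mk, bitSign]
    push_cast
    ring

variable [Fintype W] [Fintype F.edgeSet]

/-- The linear form with coefficients `θ` in the deviations. -/
noncomputable def devForm (F : SimpleGraph W) [Fintype F.edgeSet] (θ : W ⊕ F.edgeSet → ℝ)
    (ω : W → Fin 2) : ℝ := ∑ d, θ d * deviation F ω d

theorem continuous_devForm (ω : W → Fin 2) : Continuous fun θ => devForm F θ ω := by
  unfold devForm
  fun_prop

theorem devForm_smul (c : ℝ) (θ : W ⊕ F.edgeSet → ℝ) (ω : W → Fin 2) :
    devForm F (c • θ) ω = c * devForm F θ ω := by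
  simp only [devForm, Finset.mul_sum, mul_assoc, Pi.smul_apply, smul_eq_mul]

variable [DecidableEq W]

/-- The coefficients of a linear form in the deviations with respect to Walsh functions. -/
noncomputable def walshCoeff (F : SimpleGraph W) [Fintype F.edgeSet] (θ : W ⊕ F.edgeSet → ℝ) :
    W ⊕ F.edgeSet → ℝ :=
  Sum.elim (fun w => θ (.inl w) / 2 + ∑ e : F.edgeSet, if w ∈ e.1 then θ (.inr e) / 4 else 0)
    fun e => θ (.inr e) / 4

theorem devForm_eq_sum_walsh (θ : W ⊕ F.edgeSet → ℝ) (ω : W → Fin 2) :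
    devForm F θ ω = ∑ d, walshCoeff F θ d * walsh (walshIndex F d) ω := by
  have hv : ∀ w, ((ω w : ℕ) : ℝ) - 1 / 2 = bitSign (ω w) / 2 := fun w => by
    rw [bitSign]
    ring
  have he : ∀ e : F.edgeSet, (edgeProd ω e : ℝ) - 1 / 4 =
      (walsh e.1.toFinset ω + ∑ w, if w ∈ e.1 then bitSign (ω w) else 0) / 4 := fun e =>
    edgeProd_sub_eq ω (F.not_isDiag_of_mem_edgeSet e.2)
  simp only [devForm, deviation, walshCoeff, walshIndex, Fintype.sum_sum_type, Sum.elim_inl,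
    Sum.elim_inr, hv, he]
  have hw : ∀ w, walsh {w} ω = bitSign (ω w) := fun w => by simp [walsh]
  simp only [hw, add_mul, Finset.sum_add_distrib, add_div, mul_add, Finset.sum_div, Finset.mul_sum,
    Finset.sum_mul]
  rw [Finset.sum_comm (γ := W) (α := F.edgeSet)]
  have h3 : ∀ (w : W) (e : F.edgeSet), θ (.inr e) * ((if w ∈ e.1 then bitSign (ω w) else 0) / 4) =
      (if w ∈ e.1 then θ (.inr e) / 4 else 0) * bitSign (ω w) := fun w e => by
    split_ifs <;> ring
  simp only [h3]
  have h4 : ∀ w, θ (.inl w) * (bitSign (ω w) / 2) = θ (.inl w) / 2 * bitSign (ω w) := fun w => by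
    ring
  have h5 : ∀ e : F.edgeSet, θ (.inr e) * (walsh e.1.toFinset ω / 4) =
      θ (.inr e) / 4 * walsh e.1.toFinset ω := fun e => by ring
  simp only [h4, h5]
  ring

theorem sum_devForm (θ : W ⊕ F.edgeSet → ℝ) : ∑ ω, devForm F θ ω = 0 := by
  simp only [devForm_eq_sum_walsh]
  rw [Finset.sum_comm]
  refine Finset.sum_eq_zero fun d _ => ?_
  rw [← Finset.mul_sum, sum_walsh (walshIndex_nonempty d), mul_zero]

theorem sum_sq_devForm (θ : W ⊕ F.edgeSet → ℝ) :
    ∑ ω, devForm F θ ω ^ 2 = 2 ^ Fintype.card W * ∑ d, walshCoeff F θ d ^ 2 := by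
  simp only [devForm_eq_sum_walsh]
  exact sum_sq_sum_walsh walshIndex_injective _

end Deviation

/-! ### Counting homomorphisms by Fourier inversion -/

/-- The number of homomorphisms from `F` to the complete distance graph. -/
noncomputable def homCount {W : Type*} (F : SimpleGraph W) (n : ℕ) : ℕ :=
  {g : W → Vert n | ∀ u v, F.Adj u v → (distanceGraph n).Adj (g u) (g v)}.ncard

theorem distanceGraph_adj_iff {n : ℕ} (hn : 0 < n) (x y : Vert n) :
    (distanceGraph n).Adj x y ↔ 4 * ∑ i, (x.1 i : ℕ) * (y.1 i : ℕ) = n := by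
  refine ⟨fun h => h.2, fun h => ⟨?_, h⟩⟩
  rintro rfl
  have h1 : ∑ i, (x.1 i : ℕ) * (x.1 i : ℕ) = ∑ i, (x.1 i : ℕ) := by
    refine Finset.sum_congr rfl fun i _ => ?_
    generalize x.1 i = b
    fin_cases b <;> rfl
  have h2 := x.2
  omega

section Fourier

variable {ι : Type*} [Fintype ι]

theorem integral_exp_int_mul (s : ℤ) :
    ∫ x in Set.Ioc (-Real.pi) Real.pi, Complex.exp (Complex.I * ((x * s : ℝ) : ℂ)) =
      if s = 0 then ((2 * Real.pi : ℝ) : ℂ) else 0 := by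
  rw [← intervalIntegral.integral_of_le (by linarith [Real.pi_pos])]
  split_ifs with hs
  · subst hs
    simp
    ring
  · have hc : Complex.I * s ≠ 0 := mul_ne_zero Complex.I_ne_zero (by exact_mod_cast hs)
    have h := integral_exp_mul_complex (a := -Real.pi) (b := Real.pi) hc
    have h2 : ∀ x : ℝ, Complex.I * ((x * s : ℝ) : ℂ) = Complex.I * s * x := fun x => by
      push_cast
      ring
    simp only [h2]
    rw [h, div_eq_zero_iff]
    left
    rw [sub_eq_zero, Complex.exp_eq_exp_iff_exists_int]
    refine ⟨s, ?_⟩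
    push_cast
    ring

/-- Orthogonality of characters: integration over the box detects the zero vector among integer
vectors. -/
theorem integral_box_exp (s : ι → ℤ) :
    ∫ θ in Set.univ.pi fun _ : ι => Set.Ioc (-Real.pi) Real.pi,
      Complex.exp (Complex.I * ((∑ d, θ d * s d : ℝ) : ℂ)) =
        if s = 0 then ((2 * Real.pi : ℝ) : ℂ) ^ Fintype.card ι else 0 := by
  have h1 : ∀ θ : ι → ℝ, Complex.exp (Complex.I * ((∑ d, θ d * s d : ℝ) : ℂ)) =
      ∏ d, Complex.exp (Complex.I * ((θ d * s d : ℝ) : ℂ)) := fun θ => by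
    rw [← Complex.exp_sum, Complex.ofReal_sum, Finset.mul_sum]
  simp only [h1]
  rw [volume_pi, Measure.restrict_pi_pi,
    integral_fintype_prod_eq_prod fun (d : ι) (x : ℝ) => Complex.exp (Complex.I * ((x * s d : ℝ) : ℂ))]
  simp only [integral_exp_int_mul]
  split_ifs with hs
  · subst hs
    simp
  · obtain ⟨d, hd⟩ := Function.ne_iff.1 hs
    exact Finset.prod_eq_zero (Finset.mem_univ d) (if_neg hd)

end Fourier

section HomCount

variable {W : Type*} (F : SimpleGraph W)

theorem sum_deviation_eq_zero_iff {n : ℕ} (y : Fin n → W → Fin 2) :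
    (∀ d, ∑ i, deviation F (y i) d = 0) ↔
      (∀ w, 2 * ∑ i, (y i w : ℕ) = n) ∧ ∀ u v, F.Adj u v → 4 * ∑ i, (y i u : ℕ) * (y i v : ℕ) = n := by
  have h1 : ∀ w, ∑ i, deviation F (y i) (.inl w) = 0 ↔ 2 * ∑ i, (y i w : ℕ) = n := by
    intro w
    simp only [deviation, Sum.elim_inl, Finset.sum_sub_distrib, Finset.sum_const,
      Finset.card_univ, Fintype.card_fin, nsmul_eq_mul]
    rw [sub_eq_zero, ← @Nat.cast_inj ℝ]
    push_cast
    constructor <;> intro h <;> linarith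
  have h2 : ∀ u v (h : F.Adj u v), ∑ i, deviation F (y i) (.inr ⟨s(u, v), h⟩) = 0 ↔
      4 * ∑ i, (y i u : ℕ) * (y i v : ℕ) = n := by
    intro u v h
    simp only [deviation, Sum.elim_inr, Finset.sum_sub_distrib, Finset.sum_const,
      Finset.card_univ, Fintype.card_fin, nsmul_eq_mul, edgeProd_mk]
    rw [sub_eq_zero, ← @Nat.cast_inj ℝ]
    push_cast
    constructor <;> intro h <;> linarith
  constructor
  · exact fun h => ⟨fun w => (h1 w).1 (h _), fun u v huv => (h2 u v huv).1 (h _)⟩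
  · rintro ⟨ha, hb⟩ (w | ⟨e, he⟩)
    · exact (h1 w).2 (ha w)
    · induction e with | _ u v => exact (h2 u v he).2 (hb u v he)

/-- Transposition: a family of vertices indexed by `W` is read as n columns in {0,1}^W. -/
theorem homCount_eq_ncard {n : ℕ} (hn : 0 < n) :
    homCount F n = {y : Fin n → W → Fin 2 | ∀ d, ∑ i, deviation F (y i) d = 0}.ncard := by
  let T : (W → Vert n) → Fin n → W → Fin 2 := fun g i w => (g w).1 i
  have hT : Function.Injective T := fun g g' h => by
    ext w i
    exact congrArg Fin.val (congrFun (congrFun h i) w)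
  rw [homCount, ← Set.ncard_image_of_injective _ hT]
  congr 1
  ext y
  simp only [Set.mem_image, Set.mem_ofPred_eq, sum_deviation_eq_zero_iff, distanceGraph_adj_iff hn]
  constructor
  · rintro ⟨g, hg, rfl⟩
    exact ⟨fun w => (g w).2, hg⟩
  · rintro ⟨ha, hb⟩
    exact ⟨fun w => ⟨fun i => y i w, ha w⟩, hb, rfl⟩

/-- Divisibility by 4 enters here: single deviations are not integers, but the means 2m and m of the
sums are. -/
theorem exists_int_sum_deviation (m : ℕ) (y : Fin (4 * m) → W → Fin 2) :
    ∃ s : W ⊕ F.edgeSet → ℤ, ∀ d, ∑ i, deviation F (y i) d = s d := by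
  refine ⟨Sum.elim (fun w => ∑ i, (y i w : ℕ) - 2 * m) fun e => ∑ i, edgeProd (y i) e - m, ?_⟩
  rintro (w | e)
  · simp only [deviation, Sum.elim_inl, Finset.sum_sub_distrib, Finset.sum_const,
      Finset.card_univ, Fintype.card_fin, nsmul_eq_mul]
    push_cast
    ring
  · simp only [deviation, Sum.elim_inr, Finset.sum_sub_distrib, Finset.sum_const,
      Finset.card_univ, Fintype.card_fin, nsmul_eq_mul]
    push_cast
    ring

variable [Fintype W] [DecidableEq W] [Fintype F.edgeSet]

/-- The joint characteristic function of the deviations at a uniformly random point of the cube. -/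
noncomputable def devChar (θ : W ⊕ F.edgeSet → ℝ) : ℂ :=
  (∑ ω, Complex.exp (Complex.I * (devForm F θ ω : ℝ))) / 2 ^ Fintype.card W

theorem continuous_devChar : Continuous (devChar F) := by
  unfold devChar
  have := fun ω => continuous_devForm (F := F) ω
  fun_prop

/-- Expanding the power of the sum over the cube gives one exponential per sequence of columns;
integration keeps those of total deviation zero. -/
theorem homCount_eq_integral {m : ℕ} (hm : 0 < m) :
    ((2 * Real.pi : ℝ) : ℂ) ^ Fintype.card (W ⊕ F.edgeSet) * homCount F (4 * m) =
      (2 ^ Fintype.card W) ^ (4 * m) *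
        ∫ θ in Set.univ.pi fun _ : W ⊕ F.edgeSet => Set.Ioc (-Real.pi) Real.pi,
          devChar F θ ^ (4 * m) := by
  have h1 : ∀ θ, (2 ^ Fintype.card W) ^ (4 * m) * devChar F θ ^ (4 * m) =
      ∑ y : Fin (4 * m) → W → Fin 2,
        Complex.exp (Complex.I * ((∑ d, θ d * ∑ i, deviation F (y i) d : ℝ) : ℂ)) := by
    intro θ
    rw [← mul_pow, devChar, mul_comm, div_mul_cancel₀ _ (pow_ne_zero _ two_ne_zero), Fintype.sum_pow]
    refine Finset.sum_congr rfl fun y _ => ?_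
    rw [← Complex.exp_sum, ← Finset.mul_sum, ← Complex.ofReal_sum]
    congr 3
    simp only [devForm, Finset.mul_sum]
    rw [Finset.sum_comm]
  rw [← integral_const_mul]
  simp only [h1]
  rw [integral_finsetSum]
  · have h2 : ∀ y : Fin (4 * m) → W → Fin 2,
        ∫ θ in Set.univ.pi fun _ : W ⊕ F.edgeSet => Set.Ioc (-Real.pi) Real.pi,
          Complex.exp (Complex.I * ((∑ d, θ d * ∑ i, deviation F (y i) d : ℝ) : ℂ)) =
        if ∀ d, ∑ i, deviation F (y i) d = 0 then
          ((2 * Real.pi : ℝ) : ℂ) ^ Fintype.card (W ⊕ F.edgeSet) else 0 := by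
      intro y
      obtain ⟨s, hs⟩ := exists_int_sum_deviation F m y
      simp only [hs, integral_box_exp, Int.cast_eq_zero, funext_iff, Pi.zero_apply]
    simp only [h2]
    rw [← Finset.sum_filter, Finset.sum_const, homCount_eq_ncard F (by omega),
      Set.ncard_eq_toFinset_card', nsmul_eq_mul, mul_comm]
    congr 3
    ext y
    simp
  · intro y _
    refine Integrable.mono' (g := fun _ => 1) ?_ ?_ (.of_forall fun θ => ?_)
    · rw [integrable_const_iff]
      right
      refine ⟨?_⟩
      rw [Measure.restrict_apply_univ, volume_pi_pi]
      exact ENNReal.prod_lt_top fun _ _ => by simp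
    · refine Continuous.aestronglyMeasurable ?_
      fun_prop
    · rw [mul_comm, Complex.norm_exp_ofReal_mul_I]

end HomCount

/-! ### A Gaussian bound for the characteristic function -/

theorem one_sub_cos_eq (x : ℝ) : 1 - Real.cos x = 2 * Real.sin (x / 2) ^ 2 := by
  have h1 := Real.cos_two_mul (x / 2)
  have h2 := Real.sin_sq_add_cos_sq (x / 2)
  rw [show 2 * (x / 2) = x by ring] at h1
  linarith

theorem abs_sin_sub_le (x y : ℝ) : |Real.sin (x - y)| ≤ |Real.sin x| + |Real.sin y| := by
  rw [Real.sin_sub]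
  calc _ ≤ |Real.sin x * Real.cos y| + |Real.cos x * Real.sin y| := abs_sub _ _
    _ = |Real.sin x| * |Real.cos y| + |Real.cos x| * |Real.sin y| := by rw [abs_mul, abs_mul]
    _ ≤ |Real.sin x| * 1 + 1 * |Real.sin y| := by
      gcongr
      · exact Real.abs_cos_le_one y
      · exact Real.abs_cos_le_one x
    _ = _ := by ring

/-- Since 1 - cos x = 2 sin²(x/2) and |sin| is subadditive, |sin(z/2)| is at most three terms of
size √(M/2); squaring gives the 9. -/
theorem one_sub_cos_le_of_sum {x y z M : ℝ} (hx : 1 - Real.cos x ≤ M) (hy : 1 - Real.cos y ≤ M)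
    (hxyz : 1 - Real.cos (x + y + z) ≤ M) : 1 - Real.cos z ≤ 9 * M := by
  rw [one_sub_cos_eq] at hx hy hxyz ⊢
  have h1 := abs_sin_sub_le ((x + y + z) / 2 - x / 2) (y / 2)
  have h2 := abs_sin_sub_le ((x + y + z) / 2) (x / 2)
  rw [show (x + y + z) / 2 - x / 2 - y / 2 = z / 2 by ring] at h1
  rw [← sq_abs] at hx hy hxyz ⊢
  have h3 := h1.trans (add_le_add_left h2 _)
  have h0 := abs_nonneg (Real.sin (z / 2))
  have h4 := mul_self_le_mul_self h0 h3
  nlinarith [sq_nonneg (|Real.sin (x / 2)| - |Real.sin (y / 2)|),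
    sq_nonneg (|Real.sin (x / 2)| - |Real.sin ((x + y + z) / 2)|),
    sq_nonneg (|Real.sin (y / 2)| - |Real.sin ((x + y + z) / 2)|)]

theorem devForm_sub_devForm_zero {W : Type*} [Fintype W] {F : SimpleGraph W} [Fintype F.edgeSet]
    (θ : W ⊕ F.edgeSet → ℝ) (ω : W → Fin 2) :
    devForm F θ ω - devForm F θ 0 =
      ∑ w, θ (.inl w) * (ω w : ℕ) + ∑ e : F.edgeSet, θ (.inr e) * edgeProd ω e := by
  have h0 : ∀ e : Sym2 W, edgeProd (0 : W → Fin 2) e = 0 := fun e => by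
    induction e with | _ u v => rfl
  simp only [devForm, deviation, Fintype.sum_sum_type, Sum.elim_inl, Sum.elim_inr, h0,
    add_sub_add_comm, ← Finset.sum_sub_distrib]
  congr 1
  · refine Finset.sum_congr rfl fun w _ => ?_
    simp only [Pi.zero_apply, Fin.val_zero]
    push_cast
    ring
  · refine Finset.sum_congr rfl fun e _ => ?_
    push_cast
    ring

section Bound

variable {W : Type*} [DecidableEq W] {F : SimpleGraph W}

/-- The indicator vector of `{u, v}`. -/
def pairVec (u v : W) : W → Fin 2 := fun w => if w = u ∨ w = v then 1 else 0

theorem edgeProd_pairVec (u v : W) {e : Sym2 W} (he : ¬e.IsDiag) :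
    edgeProd (pairVec u v) e = if e = s(u, v) then 1 else 0 := by
  induction e with
  | _ x y =>
    have hxy : x ≠ y := he
    simp only [edgeProd_mk, pairVec, Sym2.eq_iff]
    by_cases h1 : x = u <;> by_cases h2 : x = v <;> by_cases h3 : y = u <;> by_cases h4 : y = v <;>
      simp_all

variable [Fintype W] [Fintype F.edgeSet]

theorem devForm_pairVec_self (θ : W ⊕ F.edgeSet → ℝ) (w : W) :
    devForm F θ (pairVec w w) - devForm F θ 0 = θ (.inl w) := by
  rw [devForm_sub_devForm_zero, Finset.sum_eq_single w, Finset.sum_eq_zero]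
  · simp [pairVec]
  · intro e _
    rw [edgeProd_pairVec _ _ (F.not_isDiag_of_mem_edgeSet e.2), if_neg]
    · simp
    · intro h
      exact F.not_isDiag_of_mem_edgeSet e.2 (by rw [h]; exact Sym2.mk_isDiag_iff.2 rfl)
  · intro v _ hv
    simp [pairVec, hv]
  · simp

theorem devForm_pairVec (θ : W ⊕ F.edgeSet → ℝ) {u v : W} (h : F.Adj u v) :
    devForm F θ (pairVec u v) - devForm F θ 0 =
      θ (.inl u) + θ (.inl v) + θ (.inr ⟨s(u, v), h⟩) := by
  rw [devForm_sub_devForm_zero]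
  congr 1
  · rw [← Finset.sum_pair (f := fun w => θ (.inl w)) h.ne, ← Finset.sum_subset
      (Finset.subset_univ {u, v})]
    · refine Finset.sum_congr rfl fun w hw => ?_
      rw [Finset.mem_insert, Finset.mem_singleton] at hw
      simp [pairVec, hw]
    · intro w _ hw
      rw [Finset.mem_insert, Finset.mem_singleton] at hw
      simp [pairVec, hw]
  · rw [Finset.sum_eq_single ⟨s(u, v), h⟩]
    · rw [edgeProd_pairVec _ _ (F.not_isDiag_of_mem_edgeSet h)]
      simp
    · intro e _ he
      rw [edgeProd_pairVec _ _ (F.not_isDiag_of_mem_edgeSet e.2), if_neg]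
      · simp
      · exact fun h' => he (Subtype.ext h')
    · simp

theorem sq_norm_sum_exp {ι : Type*} [Fintype ι] (a : ι → ℝ) :
    ‖∑ i, Complex.exp (Complex.I * (a i : ℝ))‖ ^ 2 = ∑ i, ∑ j, Real.cos (a i - a j) := by
  have h : ∑ i, Complex.exp (Complex.I * (a i : ℝ)) =
      ((∑ i, Real.cos (a i) : ℝ) : ℂ) + ((∑ i, Real.sin (a i) : ℝ) : ℂ) * Complex.I := by
    push_cast
    rw [Finset.sum_mul, ← Finset.sum_add_distrib]
    exact Finset.sum_congr rfl fun i _ => by rw [mul_comm, Complex.exp_mul_I]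
  rw [h, ← Complex.normSq_eq_norm_sq, Complex.normSq_add_mul_I, sq, sq, Finset.sum_mul_sum,
    Finset.sum_mul_sum]
  simp only [← Finset.sum_add_distrib, Real.cos_sub]

/-- The defect is the sum of the nonnegative numbers 1 - cos(a i - a j) over all pairs. -/
theorem one_sub_cos_le_defect {ι : Type*} [Fintype ι] (a : ι → ℝ) (i j : ι) :
    1 - Real.cos (a i - a j) ≤
      (Fintype.card ι : ℝ) ^ 2 - ‖∑ i, Complex.exp (Complex.I * (a i : ℝ))‖ ^ 2 := by
  have h0 : ∀ i j, 0 ≤ 1 - Real.cos (a i - a j) := fun i j => sub_nonneg.2 (Real.cos_le_one _)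
  have h : (Fintype.card ι : ℝ) ^ 2 - ‖∑ i, Complex.exp (Complex.I * (a i : ℝ))‖ ^ 2 =
      ∑ i, ∑ j, (1 - Real.cos (a i - a j)) := by
    rw [sq_norm_sum_exp]
    simp [Finset.sum_sub_distrib, sq]
  rw [h]
  exact (Finset.single_le_sum (fun j _ => h0 i j) (Finset.mem_univ j)).trans
    (Finset.single_le_sum (f := fun i => ∑ j, (1 - Real.cos (a i - a j)))
      (fun i _ => Finset.sum_nonneg fun j _ => h0 i j) (Finset.mem_univ i))

/-- If the modulus is near 1, all phases nearly agree modulo 2π. Comparing the zero vector with the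
indicator of a vertex isolates its coordinate of θ; the indicator of an edge then yields the edge
coordinate. In the box, being near 0 modulo 2π is controlled by 1 - cos. -/
theorem exists_norm_devChar_le (F : SimpleGraph W) [Fintype F.edgeSet] :
    ∃ c : ℝ, 0 < c ∧ ∀ θ : W ⊕ F.edgeSet → ℝ, (∀ d, |θ d| ≤ Real.pi) →
      ‖devChar F θ‖ ≤ Real.exp (-c * ∑ d, θ d ^ 2) := by
  set D : ℝ := Fintype.card (W ⊕ F.edgeSet) + 1 with hD
  have hDpos : 0 < D := by positivity
  set K : ℝ := 2 ^ Fintype.card W with hK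
  have hKpos : 0 < K := by positivity
  -- The constant comes from θ_d² ≤ (9π²/2) M for each d and ‖devChar‖² = 1 - M/K² ≤ exp(-M/K²).
  refine ⟨1 / (9 * Real.pi ^ 2 * D * K ^ 2), by positivity, fun θ hθ => ?_⟩
  set M := (Fintype.card (W → Fin 2) : ℝ) ^ 2 -
    ‖∑ ω, Complex.exp (Complex.I * (devForm F θ ω : ℝ))‖ ^ 2 with hM
  have hcard : (Fintype.card (W → Fin 2) : ℝ) = K := by simp [hK]
  have hdef := one_sub_cos_le_defect (devForm F θ)
  rw [← hM] at hdef
  have hM0 : 0 ≤ M := by simpa using hdef 0 0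
  have hd : ∀ d, 1 - Real.cos (θ d) ≤ 9 * M := by
    have hinl : ∀ w, 1 - Real.cos (θ (.inl w)) ≤ M := fun w => by
      rw [← devForm_pairVec_self (F := F) θ w]
      exact hdef _ _
    rintro (w | ⟨e, he⟩)
    · linarith [hinl w]
    · induction e with
      | _ u v =>
        refine one_sub_cos_le_of_sum (hinl u) (hinl v) ?_
        rw [← devForm_pairVec θ he]
        exact hdef _ _
  have hd2 : ∀ d, θ d ^ 2 ≤ 9 * Real.pi ^ 2 / 2 * M := fun d => by
    have h1 := Real.cos_le_one_sub_mul_cos_sq (hθ d)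
    have h2 := hd d
    have h3 : 2 / Real.pi ^ 2 * θ d ^ 2 ≤ 9 * M := by linarith
    have hpi := Real.pi_pos
    rw [div_mul_eq_mul_div, div_le_iff₀ (by positivity)] at h3
    linarith
  have hsum : ∑ d, θ d ^ 2 ≤ D * (9 * Real.pi ^ 2 / 2 * M) := by
    refine (Finset.sum_le_card_nsmul _ _ _ fun d _ => hd2 d).trans ?_
    rw [nsmul_eq_mul, Finset.card_univ]
    have : 0 ≤ 9 * Real.pi ^ 2 / 2 * M := by positivity
    gcongr
    linarith
  have hnorm : ‖devChar F θ‖ ^ 2 = 1 - M / K ^ 2 := by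
    rw [devChar, norm_div, div_pow, norm_pow, Complex.norm_ofNat, ← hK, hM, hcard]
    field_simp
    ring
  have hle : ‖devChar F θ‖ ^ 2 ≤ Real.exp (-(1 / (9 * Real.pi ^ 2 * D * K ^ 2)) * ∑ d, θ d ^ 2) ^ 2 := by
    rw [hnorm, ← Real.exp_nat_mul]
    refine (Real.one_sub_le_exp_neg _).trans (Real.exp_le_exp.2 ?_)
    push_cast
    rw [neg_mul, mul_neg, neg_le_neg_iff]
    calc 2 * (1 / (9 * Real.pi ^ 2 * D * K ^ 2) * ∑ d, θ d ^ 2)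
        ≤ 2 * (1 / (9 * Real.pi ^ 2 * D * K ^ 2) * (D * (9 * Real.pi ^ 2 / 2 * M))) := by gcongr
      _ = M / K ^ 2 := by
        have := Real.pi_pos
        field_simp
  exact le_of_sq_le_sq hle (by positivity)

end Bound

/-! ### The Gaussian limit -/

section Limit

variable {W : Type*} [Fintype W] [DecidableEq W] (F : SimpleGraph W) [Fintype F.edgeSet]

/-- The covariance form of the deviations. -/
noncomputable def devVariance (θ : W ⊕ F.edgeSet → ℝ) : ℝ := ∑ d, walshCoeff F θ d ^ 2

theorem norm_exp_sub_taylor_le {x : ℝ} (hx : |x| ≤ 1) :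
    ‖Complex.exp (Complex.I * x) - (1 + Complex.I * x - (x : ℂ) ^ 2 / 2)‖ ≤ |x| ^ 3 := by
  have hn : ‖Complex.I * (x : ℂ)‖ = |x| := by simp
  have h := Complex.exp_bound (x := Complex.I * x) (hn.trans_le hx) (n := 3) (by norm_num)
  rw [hn] at h
  have h2 : ∑ m ∈ Finset.range 3, (Complex.I * (x : ℂ)) ^ m / m.factorial =
      1 + Complex.I * x - (x : ℂ) ^ 2 / 2 := by
    simp [Finset.sum_range_succ, mul_pow, Nat.factorial]
    ring
  rw [h2] at h
  refine h.trans (mul_le_of_le_one_right (by positivity) ?_)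
  norm_num [Nat.factorial]

/-- The linear term, of order √n after multiplication by n, is subtracted here; it cancels in the
sum over the cube. -/
theorem tendsto_mul_exp_sub (a : ℝ) :
    Tendsto (fun n : ℕ => (n : ℂ) * (Complex.exp (Complex.I * (((√n)⁻¹ * a : ℝ) : ℂ)) - 1 -
      Complex.I * (((√n)⁻¹ * a : ℝ) : ℂ))) atTop (𝓝 (-((a : ℂ) ^ 2 / 2))) := by
  have h0 : Tendsto (fun n : ℕ => (√n)⁻¹ * a) atTop (𝓝 0) := by
    have := (tendsto_inv_atTop_zero.comp
      (Real.tendsto_sqrt_atTop.comp tendsto_natCast_atTop_atTop)).mul_const (b := a)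
    simpa using this
  have hsmall : ∀ᶠ n : ℕ in atTop, |(√n)⁻¹ * a| ≤ 1 := by
    filter_upwards [h0.abs.eventually (gt_mem_nhds (show |(0 : ℝ)| < 1 by simp))] with n hn
    exact hn.le
  rw [tendsto_iff_norm_sub_tendsto_zero]
  have hlim : Tendsto (fun n : ℕ => |(√n)⁻¹ * a| * a ^ 2) atTop (𝓝 0) := by
    simpa using h0.abs.mul_const (a ^ 2)
  refine squeeze_zero' (.of_forall fun _ => norm_nonneg _) ?_ hlim
  filter_upwards [hsmall, eventually_gt_atTop 0] with n hn hn0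
  have hn0' : (0 : ℝ) < n := by exact_mod_cast hn0
  have hsq : ((√n)⁻¹ * a) ^ 2 * n = a ^ 2 := by
    rw [mul_pow, inv_pow, Real.sq_sqrt hn0'.le]
    field_simp
  have hsq' : ((((√n)⁻¹ * a : ℝ)) : ℂ) ^ 2 * n = (a : ℂ) ^ 2 := by exact_mod_cast hsq
  have hT := norm_exp_sub_taylor_le hn
  set x : ℝ := (√n)⁻¹ * a
  have heq : (n : ℂ) * (Complex.exp (Complex.I * x) - 1 - Complex.I * x) - -((a : ℂ) ^ 2 / 2) =
      n * (Complex.exp (Complex.I * x) - (1 + Complex.I * x - (x : ℂ) ^ 2 / 2)) := by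
    rw [← hsq']
    ring
  rw [heq, norm_mul, Complex.norm_natCast]
  calc (n : ℝ) * _ ≤ n * |x| ^ 3 := by gcongr
    _ = |x| * (|x| ^ 2 * n) := by ring
    _ = |x| * a ^ 2 := by rw [sq_abs, hsq]

theorem tendsto_devChar_pow (θ : W ⊕ F.edgeSet → ℝ) :
    Tendsto (fun n : ℕ => devChar F ((√n)⁻¹ • θ) ^ n) atTop
      (𝓝 ((Real.exp (-(devVariance F θ / 2)) : ℝ) : ℂ)) := by
  have h2 : (2 : ℂ) ^ Fintype.card W ≠ 0 := pow_ne_zero _ two_ne_zero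
  have hg : Tendsto (fun n : ℕ => (n : ℂ) * (devChar F ((√n)⁻¹ • θ) - 1)) atTop
      (𝓝 ((-(devVariance F θ / 2) : ℝ) : ℂ)) := by
    have h1 : Tendsto (fun n : ℕ => (∑ ω, (n : ℂ) *
        (Complex.exp (Complex.I * (((√n)⁻¹ * devForm F θ ω : ℝ) : ℂ)) - 1 -
          Complex.I * (((√n)⁻¹ * devForm F θ ω : ℝ) : ℂ))) / 2 ^ Fintype.card W) atTop
        (𝓝 ((∑ ω, -((devForm F θ ω : ℂ) ^ 2 / 2)) / 2 ^ Fintype.card W)) :=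
      (tendsto_finsetSum _ fun ω _ => tendsto_mul_exp_sub _).div_const _
    have hval : (∑ ω, -((devForm F θ ω : ℂ) ^ 2 / 2)) / 2 ^ Fintype.card W =
        ((-(devVariance F θ / 2) : ℝ) : ℂ) := by
      have h3 := congrArg (fun x : ℝ => (x : ℂ)) (sum_sq_devForm (F := F) θ)
      simp only [Complex.ofReal_sum, Complex.ofReal_pow] at h3
      rw [Finset.sum_neg_distrib, ← Finset.sum_div, h3, devVariance]
      push_cast
      field_simp
    rw [← hval]
    refine h1.congr fun n => ?_
    have hlin : ∑ ω, Complex.I * (((√n)⁻¹ * devForm F θ ω : ℝ) : ℂ) = 0 := by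
      rw [← Finset.mul_sum, ← Complex.ofReal_sum, ← Finset.mul_sum, sum_devForm]
      simp
    rw [← Finset.mul_sum, Finset.sum_sub_distrib, Finset.sum_sub_distrib, hlin, devChar]
    simp only [devForm_smul]
    simp
    field_simp
  have := Complex.tendsto_one_add_pow_exp_of_tendsto hg
  rw [← Complex.ofReal_exp] at this
  exact this.congr fun n => by rw [add_sub_cancel]

end Limit

/-! ### The local limit theorem for homomorphism counts -/

section LocalLimit

variable {W : Type*} [Fintype W] [DecidableEq W] (F : SimpleGraph W) [Fintype F.edgeSet]

theorem integrable_exp_neg_mul_sum_sq {ι : Type*} [Fintype ι] {c : ℝ} (hc : 0 < c) :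
    Integrable fun θ : ι → ℝ => Real.exp (-c * ∑ d, θ d ^ 2) := by
  have h : ∀ θ : ι → ℝ, Real.exp (-c * ∑ d, θ d ^ 2) = ∏ d, Real.exp (-c * θ d ^ 2) := fun θ => by
    rw [← Real.exp_sum, Finset.mul_sum]
  simp only [h]
  exact Integrable.fintype_prod fun _ => integrable_exp_neg_mul_sq hc

theorem abs_le_pi_of_mem_box {ι : Type*} {θ : ι → ℝ}
    (h : θ ∈ Set.univ.pi fun _ : ι => Set.Ioc (-Real.pi) Real.pi) (d : ι) : |θ d| ≤ Real.pi :=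
  abs_le.2 ⟨(h d trivial).1.le, (h d trivial).2⟩

theorem eventually_inv_sqrt_smul_mem_box {ι : Type*} [Finite ι] (θ : ι → ℝ) :
    ∀ᶠ n : ℕ in atTop, (√n)⁻¹ • θ ∈ Set.univ.pi fun _ : ι => Set.Ioc (-Real.pi) Real.pi := by
  have h0 : ∀ a : ℝ, Tendsto (fun n : ℕ => (√n)⁻¹ * a) atTop (𝓝 0) := fun a => by
    have := (tendsto_inv_atTop_zero.comp
      (Real.tendsto_sqrt_atTop.comp tendsto_natCast_atTop_atTop)).mul_const (b := a)
    simpa using this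
  have h1 : ∀ d, ∀ᶠ n : ℕ in atTop, (√n)⁻¹ * θ d ∈ Set.Ioc (-Real.pi) Real.pi := fun d =>
    (h0 (θ d)).eventually (Ioc_mem_nhds (neg_neg_of_pos Real.pi_pos) Real.pi_pos)
  filter_upwards [eventually_all.2 h1] with n hn d _
  exact hn d

theorem sum_sq_inv_sqrt_smul {ι : Type*} [Fintype ι] {n : ℕ} (hn : 0 < n) (θ : ι → ℝ) :
    n * ∑ d, ((√n)⁻¹ • θ) d ^ 2 = ∑ d, θ d ^ 2 := by
  have hn' : (0 : ℝ) < n := by exact_mod_cast hn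
  simp only [Pi.smul_apply, smul_eq_mul, mul_pow, inv_pow, Real.sq_sqrt hn'.le, ← Finset.mul_sum]
  field_simp

theorem norm_devChar_pow_le {c : ℝ} (hc : ∀ θ : W ⊕ F.edgeSet → ℝ, (∀ d, |θ d| ≤ Real.pi) →
      ‖devChar F θ‖ ≤ Real.exp (-c * ∑ d, θ d ^ 2)) {n : ℕ} (hn : 0 < n) {θ : W ⊕ F.edgeSet → ℝ}
    (hθ : (√n)⁻¹ • θ ∈ Set.univ.pi fun _ : W ⊕ F.edgeSet => Set.Ioc (-Real.pi) Real.pi) :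
    ‖devChar F ((√n)⁻¹ • θ) ^ n‖ ≤ Real.exp (-c * ∑ d, θ d ^ 2) := by
  rw [norm_pow]
  refine (pow_le_pow_left₀ (norm_nonneg _) (hc _ (abs_le_pi_of_mem_box hθ)) n).trans_eq ?_
  rw [← Real.exp_nat_mul, ← sum_sq_inv_sqrt_smul hn θ]
  congr 1
  ring

theorem measurableSet_box {ι : Type*} [Countable ι] :
    MeasurableSet (Set.univ.pi fun _ : ι => Set.Ioc (-Real.pi) Real.pi) :=
  MeasurableSet.univ_pi fun _ => measurableSet_Ioc

/-- Rescaling θ by 1/√n produces the power of √n and an expanding box; dominated convergence applies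
with the Gaussian majorant. -/
theorem tendsto_integral_devChar_pow :
    Tendsto (fun n : ℕ => ((√n : ℝ) : ℂ) ^ Fintype.card (W ⊕ F.edgeSet) *
      ∫ θ in Set.univ.pi fun _ : W ⊕ F.edgeSet => Set.Ioc (-Real.pi) Real.pi, devChar F θ ^ n) atTop
      (𝓝 ((∫ θ, Real.exp (-(devVariance F θ / 2)) : ℝ) : ℂ)) := by
  obtain ⟨c, hc, hbound⟩ := exists_norm_devChar_le F
  set B := Set.univ.pi fun _ : W ⊕ F.edgeSet => Set.Ioc (-Real.pi) Real.pi with hB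
  have hlim : Tendsto (fun n : ℕ => ∫ θ : W ⊕ F.edgeSet → ℝ,
      B.indicator (fun θ => devChar F θ ^ n) ((√n)⁻¹ • θ)) atTop
      (𝓝 (∫ θ : W ⊕ F.edgeSet → ℝ, ((Real.exp (-(devVariance F θ / 2)) : ℝ) : ℂ))) := by
    refine tendsto_integral_filter_of_dominated_convergence
      (fun θ => Real.exp (-c * ∑ d, θ d ^ 2)) (.of_forall fun n => ?_) ?_
      (integrable_exp_neg_mul_sum_sq hc) (.of_forall fun θ => ?_)
    · have h1 : Measurable (B.indicator fun θ => devChar F θ ^ n) :=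
        ((continuous_devChar F).pow n).measurable.indicator measurableSet_box
      exact (h1.comp (measurable_const_smul _)).aestronglyMeasurable
    · filter_upwards [eventually_gt_atTop 0] with n hn
      refine .of_forall fun θ => ?_
      by_cases h : (√n)⁻¹ • θ ∈ B
      · rw [Set.indicator_of_mem h]
        exact norm_devChar_pow_le F hbound hn h
      · rw [Set.indicator_of_notMem h, norm_zero]
        positivity
    · refine (tendsto_devChar_pow F θ).congr' ?_
      filter_upwards [eventually_inv_sqrt_smul_mem_box θ] with n hn
      rw [Set.indicator_of_mem hn]
  rw [integral_complex_ofReal] at hlim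
  refine hlim.congr fun n => ?_
  rw [Measure.integral_comp_smul volume (B.indicator fun θ => devChar F θ ^ n),
    integral_indicator measurableSet_box, Module.finrank_pi, ← inv_pow, inv_inv,
    abs_of_nonneg (by positivity), Complex.real_smul]
  push_cast
  rfl

/-- The majorant passes to the limit, which gives integrability without proving the covariance form
nondegenerate. -/
theorem exp_neg_devVariance_le {c : ℝ} (hc : ∀ θ : W ⊕ F.edgeSet → ℝ, (∀ d, |θ d| ≤ Real.pi) →
      ‖devChar F θ‖ ≤ Real.exp (-c * ∑ d, θ d ^ 2)) (θ : W ⊕ F.edgeSet → ℝ) :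
    Real.exp (-(devVariance F θ / 2)) ≤ Real.exp (-c * ∑ d, θ d ^ 2) := by
  have h := (tendsto_devChar_pow F θ).norm
  rw [Complex.norm_real, Real.norm_eq_abs, Real.abs_exp] at h
  refine le_of_tendsto h ?_
  filter_upwards [eventually_inv_sqrt_smul_mem_box θ, eventually_gt_atTop 0] with n hn hn0
  exact norm_devChar_pow_le F hc hn0 hn

theorem continuous_devVariance : Continuous (devVariance F) := by
  unfold devVariance
  refine continuous_finsetSum _ fun d _ => ?_
  rcases d with w | e
  · simp only [walshCoeff, Sum.elim_inl]
    refine Continuous.pow (Continuous.add (by fun_prop) (continuous_finsetSum _ fun e _ => ?_)) 2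
    split_ifs
    · fun_prop
    · fun_prop
  · simp only [walshCoeff, Sum.elim_inr]
    fun_prop

theorem integrable_exp_neg_devVariance :
    Integrable fun θ => Real.exp (-(devVariance F θ / 2)) := by
  obtain ⟨c, hc, hbound⟩ := exists_norm_devChar_le F
  refine (integrable_exp_neg_mul_sum_sq hc).mono' ?_ (.of_forall fun θ => ?_)
  · have := continuous_devVariance F
    exact Continuous.aestronglyMeasurable (by fun_prop)
  · rw [Real.norm_eq_abs, Real.abs_exp]
    exact exp_neg_devVariance_le F hbound θ

/-- With the edge coordinates fixed, they only translate the vertex coordinates, and translation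
invariance removes the shift. -/
theorem integral_exp_neg_devVariance :
    ∫ θ, Real.exp (-(devVariance F θ / 2)) =
      (∫ x : ℝ, Real.exp (-((x / 2) ^ 2 / 2))) ^ Fintype.card W *
        (∫ x : ℝ, Real.exp (-((x / 4) ^ 2 / 2))) ^ Fintype.card F.edgeSet := by
  have hmp := volume_measurePreserving_sumPiEquivProdPi_symm fun _ : W ⊕ F.edgeSet => ℝ
  set Φ := (MeasurableEquiv.sumPiEquivProdPi fun _ : W ⊕ F.edgeSet => ℝ).symm with hΦ
  let shift : (F.edgeSet → ℝ) → W → ℝ := fun s w => ∑ e : F.edgeSet, if w ∈ e.1 then s e / 4 else 0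
  have hval : ∀ z : (W → ℝ) × (F.edgeSet → ℝ), Real.exp (-(devVariance F (Φ z) / 2)) =
      (∏ w, Real.exp (-(((z.1 + 2 • shift z.2) w / 2) ^ 2 / 2))) *
        ∏ e, Real.exp (-((z.2 e / 4) ^ 2 / 2)) := by
    intro z
    rw [← Real.exp_sum, ← Real.exp_sum, ← Real.exp_add, devVariance, Fintype.sum_sum_type]
    congr 1
    rw [add_div, neg_add, Finset.sum_div, Finset.sum_div, ← Finset.sum_neg_distrib,
      ← Finset.sum_neg_distrib]
    congr 1
    refine Finset.sum_congr rfl fun w _ => ?_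
    have : walshCoeff F (Φ z) (.inl w) = (z.1 + 2 • shift z.2) w / 2 := by
      change z.1 w / 2 + shift z.2 w = (z.1 w + (2 • shift z.2) w) / 2
      rw [Pi.smul_apply, nsmul_eq_mul]
      push_cast
      ring
    rw [this]
  have hint : Integrable (fun z => Real.exp (-(devVariance F (Φ z) / 2))) :=
    hmp.integrable_comp_of_integrable (integrable_exp_neg_devVariance F)
  rw [← hmp.integral_comp' (g := fun θ => Real.exp (-(devVariance F θ / 2))), Measure.volume_eq_prod,
    integral_prod_symm _ hint]
  simp only [hval]
  have hinner : ∀ s : F.edgeSet → ℝ,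
      ∫ x : W → ℝ, (∏ w, Real.exp (-(((x + 2 • shift s) w / 2) ^ 2 / 2))) *
        ∏ e, Real.exp (-((s e / 4) ^ 2 / 2)) =
      (∫ x : ℝ, Real.exp (-((x / 2) ^ 2 / 2))) ^ Fintype.card W *
        ∏ e, Real.exp (-((s e / 4) ^ 2 / 2)) := by
    intro s
    rw [integral_mul_const,
      integral_add_right_eq_self (fun x : W → ℝ => ∏ w, Real.exp (-((x w / 2) ^ 2 / 2))),
      integral_fintype_prod_volume_eq_pow fun x : ℝ => Real.exp (-((x / 2) ^ 2 / 2))]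
  simp only [hinner]
  rw [integral_const_mul,
    integral_fintype_prod_volume_eq_pow fun x : ℝ => Real.exp (-((x / 4) ^ 2 / 2))]

theorem tendsto_homCount :
    Tendsto (fun m : ℕ => (homCount F (4 * m) : ℝ) *
      (2 * Real.pi * √(4 * m : ℕ)) ^ (Fintype.card W + Fintype.card F.edgeSet) /
        (2 ^ (4 * m)) ^ Fintype.card W) atTop
      (𝓝 ((∫ x : ℝ, Real.exp (-((x / 2) ^ 2 / 2))) ^ Fintype.card W *
        (∫ x : ℝ, Real.exp (-((x / 4) ^ 2 / 2))) ^ Fintype.card F.edgeSet)) := by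
  rw [← integral_exp_neg_devVariance]
  have h4 : Tendsto (fun m : ℕ => 4 * m) atTop atTop := tendsto_id.const_mul_atTop' (by norm_num)
  have h := (tendsto_integral_devChar_pow F).comp h4
  have h2 := (Complex.continuous_re.tendsto _).comp h
  rw [Complex.ofReal_re] at h2
  refine h2.congr' ?_
  filter_upwards [eventually_gt_atTop 0] with m hm
  have h3 := homCount_eq_integral F hm
  simp only [Function.comp_apply]
  set J := ∫ θ in Set.univ.pi fun _ : W ⊕ F.edgeSet => Set.Ioc (-Real.pi) Real.pi,
    devChar F θ ^ (4 * m)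
  have hK : (((2 : ℂ) ^ Fintype.card W) ^ (4 * m)) ≠ 0 := by
    exact pow_ne_zero _ (pow_ne_zero _ two_ne_zero)
  have hJ : J = (((2 * Real.pi) ^ Fintype.card (W ⊕ F.edgeSet) * homCount F (4 * m) /
      (2 ^ Fintype.card W) ^ (4 * m) : ℝ) : ℂ) := by
    push_cast at h3 ⊢
    rw [h3, mul_div_cancel_left₀ _ hK]
  rw [hJ, ← Complex.ofReal_pow, ← Complex.ofReal_mul, Complex.ofReal_re, Fintype.card_sum, mul_pow,
    ← pow_mul, ← pow_mul, mul_comm (Fintype.card W) (4 * m)]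
  ring

end LocalLimit

/-! ### Asymptotics of the complete distance graph -/

/-- The one-vertex and one-edge graphs calibrate the two Gaussian constants. -/
theorem homCount_bot_fin_one (n : ℕ) : homCount (⊥ : SimpleGraph (Fin 1)) n = numVert n := by
  have h : {g : Fin 1 → Vert n | ∀ u v, (⊥ : SimpleGraph (Fin 1)).Adj u v →
      (distanceGraph n).Adj (g u) (g v)} = Set.univ := by
    ext g
    simp
  rw [homCount, h, Set.ncard_univ, Nat.card_eq_fintype_card, numVert]
  simp

theorem homCount_top_fin_two (n : ℕ) :
    homCount (⊤ : SimpleGraph (Fin 2)) n = numVert n * vertDegree n := by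
  classical
  have h : homCount (⊤ : SimpleGraph (Fin 2)) n =
      Nat.card (Σ x : Vert n, (distanceGraph n).neighborSet x) := by
    rw [homCount, ← Nat.card_coe_set_eq]
    refine Nat.card_congr ⟨fun g => ⟨g.1 0, g.1 1, g.2 0 1 (by simp)⟩,
      fun x => ⟨![x.1, x.2.1], fun u v huv => ?_⟩, fun g => ?_, fun x => ?_⟩
    · fin_cases u <;> fin_cases v
      · exact absurd rfl huv
      · exact x.2.2
      · exact SimpleGraph.Adj.symm x.2.2
      · exact absurd rfl huv
    · refine Subtype.ext (funext fun i => ?_)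
      fin_cases i <;> rfl
    · rfl
  rw [h, Nat.card_sigma]
  have h2 : ∀ x : Vert n, Nat.card ((distanceGraph n).neighborSet x) = vertDegree n := fun x => by
    rw [Nat.card_eq_fintype_card, SimpleGraph.card_neighborSet_eq_degree]
    exact isRegularOfDegree_distanceGraph n x
  simp only [h2, Finset.sum_const, Finset.card_univ, smul_eq_mul, numVert]

theorem integral_exp_neg_div_sq_pos {a : ℝ} (ha : 0 < a) :
    0 < ∫ x : ℝ, Real.exp (-((x / a) ^ 2 / 2)) := by
  have h : ∀ x : ℝ, -((x / a) ^ 2 / 2) = -(1 / (2 * a ^ 2)) * x ^ 2 := fun x => by field_simp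
  simp only [h]
  rw [integral_gaussian]
  have := Real.pi_pos
  positivity

/-- The normalizing factor `2π√n` at `n = 4m`. -/
noncomputable def localScale (m : ℕ) : ℝ := 2 * Real.pi * √(4 * m : ℕ)

theorem localScale_pos {m : ℕ} (hm : 0 < m) : 0 < localScale m := by
  have := Real.pi_pos
  unfold localScale
  positivity

/-- The Gaussian integral governing the number of vertices. -/
noncomputable def vertConst : ℝ := ∫ x : ℝ, Real.exp (-((x / 2) ^ 2 / 2))

/-- The Gaussian integral governing the edge density. -/
noncomputable def adjConst : ℝ := ∫ x : ℝ, Real.exp (-((x / 4) ^ 2 / 2))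

theorem vertConst_pos : 0 < vertConst := integral_exp_neg_div_sq_pos two_pos

theorem adjConst_pos : 0 < adjConst := integral_exp_neg_div_sq_pos four_pos

/-- The edge density `N₁ / N` of the complete distance graph. -/
noncomputable def density (n : ℕ) : ℝ := (vertDegree n : ℝ) / numVert n

theorem tendsto_numVert :
    Tendsto (fun m : ℕ => (numVert (4 * m) : ℝ) * localScale m / 2 ^ (4 * m)) atTop
      (𝓝 vertConst) := by
  have h := tendsto_homCount (⊥ : SimpleGraph (Fin 1))
  have he : Fintype.card (⊥ : SimpleGraph (Fin 1)).edgeSet = 0 := by simp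
  simp only [homCount_bot_fin_one, he, Fintype.card_fin, pow_one, pow_zero, mul_one, add_zero] at h
  exact h

theorem eventually_numVert_pos : ∀ᶠ m : ℕ in atTop, (0 : ℝ) < numVert (4 * m) := by
  filter_upwards [tendsto_numVert.eventually (lt_mem_nhds vertConst_pos)] with m hm
  refine lt_of_le_of_ne (Nat.cast_nonneg _) fun h => ?_
  rw [← h] at hm
  simp at hm

theorem tendsto_density :
    Tendsto (fun m : ℕ => density (4 * m) * localScale m) atTop (𝓝 adjConst) := by
  have h := tendsto_homCount (⊤ : SimpleGraph (Fin 2))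
  have he : Fintype.card (⊤ : SimpleGraph (Fin 2)).edgeSet = 1 := by
    rw [← SimpleGraph.edgeFinset_card, SimpleGraph.card_edgeFinset_top_eq_card_choose_two]
    rfl
  simp only [homCount_top_fin_two, he, Fintype.card_fin, pow_one] at h
  -- The edge count N N₁ divided by N² is the density, and `vertConst` cancels.
  have h2 := h.div (tendsto_numVert.pow 2) (pow_ne_zero _ vertConst_pos.ne')
  rw [← vertConst, ← adjConst, mul_div_cancel_left₀ _ (pow_ne_zero _ vertConst_pos.ne')] at h2
  refine h2.congr' ?_
  filter_upwards [eventually_numVert_pos, eventually_gt_atTop 0] with m hm hm0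
  have hs := localScale_pos hm0
  simp only [Pi.div_apply, density]
  rw [← localScale]
  push_cast
  field_simp

theorem eventually_density_pos : ∀ᶠ m : ℕ in atTop, (0 : ℝ) < density (4 * m) := by
  filter_upwards [tendsto_density.eventually (lt_mem_nhds adjConst_pos), eventually_gt_atTop 0]
    with m hm hm0
  exact pos_of_mul_pos_left hm (localScale_pos hm0).le

theorem tendsto_homCount_div {W : Type*} [Fintype W] [DecidableEq W] (F : SimpleGraph W)
    [Fintype F.edgeSet] :
    Tendsto (fun m : ℕ => (homCount F (4 * m) : ℝ) / ((numVert (4 * m) : ℝ) ^ Fintype.card W *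
      density (4 * m) ^ Fintype.card F.edgeSet)) atTop (𝓝 1) := by
  have hA : vertConst ^ Fintype.card W ≠ 0 := pow_ne_zero _ vertConst_pos.ne'
  have hB : adjConst ^ Fintype.card F.edgeSet ≠ 0 := pow_ne_zero _ adjConst_pos.ne'
  have h := (tendsto_homCount F).div ((tendsto_numVert.pow (Fintype.card W)).mul
    (tendsto_density.pow (Fintype.card F.edgeSet))) (mul_ne_zero hA hB)
  rw [← vertConst, ← adjConst, div_self (mul_ne_zero hA hB)] at h
  refine h.congr' ?_
  filter_upwards [eventually_numVert_pos, eventually_density_pos, eventually_gt_atTop 0]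
    with m hm hq hm0
  have hs := localScale_pos hm0
  simp only [Pi.div_apply]
  rw [← localScale, div_pow, mul_pow, mul_pow, pow_add]
  field_simp

theorem tendsto_localScale_rpow_mul (γ : ℝ) {δ : ℝ} (hδ : 0 < δ) :
    Tendsto (fun m : ℕ => localScale m ^ γ * ((2 : ℝ) ^ (4 * m)) ^ (-δ)) atTop (𝓝 0) := by
  have h4 : Tendsto (fun m : ℕ => ((4 * m : ℕ) : ℝ)) atTop atTop :=
    tendsto_natCast_atTop_atTop.comp (tendsto_id.const_mul_atTop' (by norm_num))
  have h := ((tendsto_rpow_mul_exp_neg_mul_atTop_nhds_zero (γ / 2) (δ * Real.log 2)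
    (by positivity)).comp h4).const_mul ((2 * Real.pi) ^ γ)
  rw [mul_zero] at h
  refine h.congr fun m => ?_
  have hpi := Real.pi_pos
  have h1 : ((2 : ℝ) ^ (4 * m)) ^ (-δ) = Real.exp (-(δ * Real.log 2) * ((4 * m : ℕ) : ℝ)) := by
    rw [Real.rpow_def_of_pos (by positivity), Real.log_pow]
    congr 1
    ring
  rw [Function.comp_apply, h1, localScale,
    Real.mul_rpow (x := 2 * Real.pi) (by positivity) (by positivity),
    Real.sqrt_eq_rpow, ← Real.rpow_mul (by positivity)]
  ring_nf

/-- N has order 2^n/√n and the density order 1/√n, so a negative power of N beats every power of the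
density. -/
theorem tendsto_numVert_rpow_mul {δ : ℝ} (hδ : 0 < δ) (β : ℝ) :
    Tendsto (fun m : ℕ => (numVert (4 * m) : ℝ) ^ (-δ) * density (4 * m) ^ (-β)) atTop (𝓝 0) := by
  have h1 := tendsto_numVert.rpow_const (p := -δ) (.inl vertConst_pos.ne')
  have h2 := tendsto_density.rpow_const (p := -β) (.inl adjConst_pos.ne')
  have h := (h1.mul h2).mul (tendsto_localScale_rpow_mul (δ + β) hδ)
  rw [mul_zero] at h
  refine h.congr' ?_
  filter_upwards [eventually_numVert_pos, eventually_density_pos, eventually_gt_atTop 0]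
    with m hm hq hm0
  have hs := localScale_pos hm0
  have hP : (0 : ℝ) < 2 ^ (4 * m) := by positivity
  rw [Real.div_rpow (by positivity) hP.le, Real.mul_rpow hm.le hs.le, Real.mul_rpow hq.le hs.le,
    Real.rpow_add hs, Real.rpow_neg hs.le δ, Real.rpow_neg hs.le β]
  have := Real.rpow_pos_of_pos hs δ
  have := Real.rpow_pos_of_pos hs β
  have := Real.rpow_pos_of_pos hP (-δ)
  field_simp

/-! ### Labelled copies in the complete distance graph -/

theorem labelledCount_le_homCount {W : Type*} [Finite W] (F : SimpleGraph W) (n : ℕ) :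
    labelledCount F (distanceGraph n) ≤ homCount F n :=
  Set.ncard_le_ncard (fun _ hf => edgeImage_subset_edgeSet.1 hf.2) (Set.toFinite _)

theorem homCount_le_labelledCount_add {W : Type*} [Fintype W] (F : SimpleGraph W) (n : ℕ) :
    homCount F n ≤ labelledCount F (distanceGraph n) +
      ∑ v ∈ Finset.range (Fintype.card W), v ^ Fintype.card W * numVert n ^ v := by
  classical
  have h1 : {g : W → Vert n | ∀ u v, F.Adj u v → (distanceGraph n).Adj (g u) (g v)} ⊆
      {f : W → Vert n | Function.Injective f ∧ edgeImage F f ⊆ (distanceGraph n).edgeSet} ∪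
        ↑((Finset.range (Fintype.card W)).biUnion fun v =>
          Finset.univ.filter fun g : W → Vert n => (Set.range g).ncard = v) := by
    intro g hg
    by_cases hinj : Function.Injective g
    · exact Or.inl ⟨hinj, edgeImage_subset_edgeSet.2 hg⟩
    · right
      simp only [Finset.coe_biUnion, Set.mem_iUnion, Finset.coe_filter, Set.mem_ofPred_eq,
        Finset.mem_univ, true_and, Finset.coe_range, Set.mem_Iio, exists_prop, exists_eq_right']
      refine lt_of_le_of_ne ?_ fun h => hinj ?_
      · have := Set.ncard_image_le (Set.finite_univ (α := W)) (f := g)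
        rwa [Set.image_univ, Set.ncard_univ, Nat.card_eq_fintype_card] at this
      · rw [← Set.injOn_univ, ← Set.ncard_image_iff Set.finite_univ, Set.image_univ,
          Set.ncard_univ, Nat.card_eq_fintype_card]
        exact h
  refine (Set.ncard_le_ncard h1 (Set.toFinite _)).trans ((Set.ncard_union_le _ _).trans ?_)
  rw [Set.ncard_coe_finset]
  refine Nat.add_le_add le_rfl (Finset.card_biUnion_le.trans (Finset.sum_le_sum fun v _ => ?_))
  exact card_ncard_range_eq_le v

/-- Non-injective homomorphisms take fewer than k values, so they number O(N^(k-1)), negligible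
against N^k times a power of the density. -/
theorem tendsto_labelledCount_div {W : Type*} [Fintype W] [DecidableEq W] (F : SimpleGraph W)
    [Fintype F.edgeSet] :
    Tendsto (fun m : ℕ => (labelledCount F (distanceGraph (4 * m)) : ℝ) /
      ((numVert (4 * m) : ℝ) ^ Fintype.card W * density (4 * m) ^ Fintype.card F.edgeSet)) atTop
      (𝓝 1) := by
  have herr : Tendsto (fun m : ℕ => (homCount F (4 * m) : ℝ) /
      ((numVert (4 * m) : ℝ) ^ Fintype.card W * density (4 * m) ^ Fintype.card F.edgeSet) -
      ∑ v ∈ Finset.range (Fintype.card W), (v : ℝ) ^ Fintype.card W *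
        ((numVert (4 * m) : ℝ) ^ (-((Fintype.card W - v : ℕ) : ℝ)) *
          density (4 * m) ^ (-(Fintype.card F.edgeSet : ℝ)))) atTop (𝓝 1) := by
    have h := (tendsto_homCount_div F).sub (tendsto_finsetSum (Finset.range (Fintype.card W))
      fun v hv => (tendsto_numVert_rpow_mul (δ := ((Fintype.card W - v : ℕ) : ℝ)) (by
        have := Finset.mem_range.1 hv
        exact_mod_cast Nat.sub_pos_of_lt this) (Fintype.card F.edgeSet)).const_mul
          ((v : ℝ) ^ Fintype.card W))
    simpa using h
  refine tendsto_of_tendsto_of_tendsto_of_le_of_le' herr (tendsto_homCount_div F) ?_ ?_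
  · filter_upwards [eventually_numVert_pos, eventually_density_pos] with m hm hq
    have h : (homCount F (4 * m) : ℝ) ≤ labelledCount F (distanceGraph (4 * m)) +
        ∑ v ∈ Finset.range (Fintype.card W), (v : ℝ) ^ Fintype.card W * (numVert (4 * m) : ℝ) ^ v := by
      exact_mod_cast homCount_le_labelledCount_add F (4 * m)
    rw [sub_le_iff_le_add, div_le_iff₀ (by positivity), add_mul, div_mul_cancel₀ _ (by positivity),
      Finset.sum_mul]
    refine h.trans (add_le_add_right (Finset.sum_le_sum fun v hv => ?_) _)
    have hv' := (Finset.mem_range.1 hv).le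
    rw [Real.rpow_neg hm.le, Real.rpow_neg hq.le, Real.rpow_natCast, Real.rpow_natCast]
    have : (numVert (4 * m) : ℝ) ^ Fintype.card W =
        (numVert (4 * m) : ℝ) ^ v * (numVert (4 * m) : ℝ) ^ (Fintype.card W - v) := by
      rw [← pow_add, Nat.add_sub_cancel' hv']
    rw [this]
    apply le_of_eq
    field_simp
  · filter_upwards [eventually_numVert_pos, eventually_density_pos] with m hm hq
    have := labelledCount_le_homCount F (4 * m)
    gcongr

/-! ### The edge probability -/

theorem tendsto_four_mul_multiplesOfFour : Tendsto (fun m => 4 * m) atTop multiplesOfFour :=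
  tendsto_inf.2 ⟨tendsto_id.const_mul_atTop' (by norm_num),
    tendsto_principal.2 (.of_forall fun m => dvd_mul_right 4 m)⟩

theorem multiplesOfFour_le_map : multiplesOfFour ≤ map (fun m => 4 * m) atTop := by
  intro S hS
  obtain ⟨M, hM⟩ := mem_atTop_sets.1 (mem_map.1 hS)
  rw [multiplesOfFour, mem_inf_principal]
  filter_upwards [eventually_ge_atTop (4 * M)] with n hn h4
  obtain ⟨m, rfl⟩ := h4
  exact hM m (by omega)

section EdgeProbability

variable {k l : ℕ} {c : ℝ} {p : ℕ → ℝ}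

theorem tendsto_div_of_isEquivalent (hc : 0 < c)
    (hp : p ~[multiplesOfFour] fun n => c * (numVert n : ℝ) ^ (-((k : ℝ) / (l : ℝ))) *
      ((numVert n : ℝ) / (vertDegree n : ℝ))) :
    Tendsto (fun m => p (4 * m) / (c * (numVert (4 * m) : ℝ) ^ (-((k : ℝ) / (l : ℝ))) *
      (density (4 * m))⁻¹)) atTop (𝓝 1) := by
  have h := hp.comp_tendsto tendsto_four_mul_multiplesOfFour
  rw [isEquivalent_iff_tendsto_one] at h
  · refine h.congr fun m => ?_
    simp only [Pi.div_apply, Function.comp_apply, density, inv_div]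
  · filter_upwards [eventually_numVert_pos, eventually_density_pos] with m hm hq
    have h2 : (0 : ℝ) < (numVert (4 * m) : ℝ) / vertDegree (4 * m) := by
      rw [← inv_div]
      exact inv_pos.2 hq
    have := Real.rpow_pos_of_pos hm (-((k : ℝ) / (l : ℝ)))
    exact (mul_pos (mul_pos hc this) h2).ne'

theorem tendsto_labelledCount_mul_pow {W : Type*} [Fintype W] [DecidableEq W] {F : SimpleGraph W}
    [Fintype F.edgeSet] (hk : Fintype.card W = k) (hl : Fintype.card F.edgeSet = l) (hl0 : 0 < l)
    (hc : 0 < c) (h : Tendsto (fun m => p (4 * m) /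
      (c * (numVert (4 * m) : ℝ) ^ (-((k : ℝ) / (l : ℝ))) * (density (4 * m))⁻¹)) atTop (𝓝 1)) :
    Tendsto (fun m => (labelledCount F (distanceGraph (4 * m)) : ℝ) * p (4 * m) ^ l) atTop
      (𝓝 (c ^ l)) := by
  have h1 := ((tendsto_labelledCount_div F).mul (h.pow l)).mul_const (c ^ l)
  rw [one_pow, one_mul, one_mul] at h1
  refine h1.congr' ?_
  filter_upwards [eventually_numVert_pos, eventually_density_pos] with m hm hq
  have hl' : (l : ℝ) ≠ 0 := by exact_mod_cast hl0.ne'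
  have hpow : ((numVert (4 * m) : ℝ) ^ (-((k : ℝ) / (l : ℝ)))) ^ l =
      ((numVert (4 * m) : ℝ) ^ k)⁻¹ := by
    rw [← Real.rpow_natCast, ← Real.rpow_mul hm.le, neg_mul, div_mul_cancel₀ _ hl',
      Real.rpow_neg hm.le, Real.rpow_natCast]
  rw [hk, hl, div_pow, mul_pow, mul_pow, hpow, inv_pow]
  field_simp

/-- Since (k/l) · (vl+1)/k = v + 1/l, the powers of N combine to N^(-1/l), against a fixed power of
the inverse density. -/
theorem tendsto_numVert_pow_mul_rpow (hk0 : 0 < k) (hl0 : 0 < l) (hc : 0 < c)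
    (hp0 : ∀ n, 0 ≤ p n) (h : Tendsto (fun m => p (4 * m) /
      (c * (numVert (4 * m) : ℝ) ^ (-((k : ℝ) / (l : ℝ))) * (density (4 * m))⁻¹)) atTop (𝓝 1))
    (v : ℕ) :
    Tendsto (fun m => (numVert (4 * m) : ℝ) ^ v * p (4 * m) ^ (((v * l + 1 : ℕ) : ℝ) / k)) atTop
      (𝓝 0) := by
  set β : ℝ := ((v * l + 1 : ℕ) : ℝ) / k with hβ
  have hl' : (0 : ℝ) < l := by exact_mod_cast hl0
  have hk' : (0 : ℝ) < k := by exact_mod_cast hk0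
  have h1 := ((h.rpow_const (p := β) (.inl one_ne_zero)).mul_const (c ^ β)).mul
    (tendsto_numVert_rpow_mul (δ := 1 / l) (by positivity) β)
  rw [mul_zero] at h1
  refine h1.congr' ?_
  filter_upwards [eventually_numVert_pos, eventually_density_pos] with m hm hq
  have hN := Real.rpow_pos_of_pos hm (-((k : ℝ) / (l : ℝ)))
  have hNv : ((numVert (4 * m) : ℝ) ^ (-((k : ℝ) / (l : ℝ)))) ^ β * (numVert (4 * m) : ℝ) ^ v =
      (numVert (4 * m) : ℝ) ^ (-(1 / (l : ℝ))) := by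
    rw [← Real.rpow_mul hm.le, ← Real.rpow_natCast (numVert (4 * m) : ℝ) v, ← Real.rpow_add hm, hβ]
    congr 1
    push_cast
    field_simp
    ring
  rw [Real.div_rpow (hp0 _) (by positivity), Real.mul_rpow (by positivity) (by positivity),
    Real.mul_rpow hc.le hN.le, ← hNv, Real.inv_rpow hq.le, Real.rpow_neg hq.le]
  have := Real.rpow_pos_of_pos hc β
  have := Real.rpow_pos_of_pos hN β
  have := Real.rpow_pos_of_pos hq β
  field_simp

end EdgeProbability

end RandomDistanceGraph

open RandomDistanceGraph
theorem theorem6 {W : Type*} [Finite W] (F : SimpleGraph W) (hF : IsStrictlyBalanced F)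
    (k l a : ℕ) (hk : Nat.card W = k) (hl : F.edgeSet.ncard = l) (ha : Nat.card (F ≃g F) = a)
    (hl0 : 0 < l) (c : ℝ) (hc : 0 < c) (p : ℕ → unitInterval)
    (hp : (fun n => (p n : ℝ)) ~[multiplesOfFour]
      fun n => c * (numVert n : ℝ) ^ (-((k : ℝ) / (l : ℝ))) *
        ((numVert n : ℝ) / (vertDegree n : ℝ))) :
    TendstoInDistribution
      (fun (n : ℕ) (H : SimpleGraph (Vert n)) => (H.copyCount F : ℝ)) multiplesOfFour
      (fun j : ℕ => (j : ℝ))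
      (fun n => randomSubgraph (distanceGraph n) (p n))
      (poissonMeasure (Real.toNNReal (c ^ l / (a : ℝ)))) := by
  classical
  have := Fintype.ofFinite W
  subst ha
  have hk1 : Fintype.card W = k := by rw [← hk, Nat.card_eq_fintype_card]
  have hl1 : Fintype.card F.edgeSet = l := by
    rw [← hl, ← Nat.card_coe_set_eq, Nat.card_eq_fintype_card]
  have hk0 : 0 < k := by
    obtain ⟨e, -⟩ := Set.nonempty_of_ncard_ne_zero (hl.trans_ne hl0.ne')
    rw [← hk1]
    induction e with | _ u v => exact Fintype.card_pos_iff.2 ⟨u⟩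
  have hratio := tendsto_div_of_isEquivalent hc hp
  have h := tendstoInDistribution_copyCount hF (hl0.trans_eq hl.symm)
    (fun m => distanceGraph (4 * m)) (fun m => p (4 * m)) (c := c ^ l) (by
      rw [hl]
      exact tendsto_labelledCount_mul_pow (p := fun n => (p n : ℝ)) hk1 hl1 hl0 hc hratio) (by
      rw [hl, hk]
      exact tendsto_numVert_pow_mul_rpow (p := fun n => (p n : ℝ)) hk0 hl0 hc (fun n => (p n).2.1) hratio)
  -- Measurability is required for every n, whereas `h` only concerns multiples of 4.
  have hmeas : ∀ n, AEMeasurable (fun H : SimpleGraph (Vert n) => (H.copyCount F : ℝ))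
      (randomSubgraph (distanceGraph n) (p n)) := fun n =>
    Measurable.aemeasurable fun s _ => measurableSet_simpleGraph _
  exact ⟨hmeas, h.aemeasurable_limit,
    (tendsto_map'_iff.2 h.tendsto).mono_left multiplesOfFour_le_map⟩
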